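/- Let $N\ge 1$, let $\mathbb T^N=\mathbb R^N/\mathbb Z^N$ be the unit torus, let $A_0\in L^\infty(\mathbb T^N;\mathbb R^{N\times N})$ be symmetric and uniformly coercive (there is $\alpha>0$ with $A_0(y)\xi\cdot\xi\ge\alpha|\xi|^2$ for all $\xi\in\mathbb R^N$ and a.e. $y$), and let $\rho_0\in L^\infty(\mathbb T^N;\mathbb R)$ satisfy $\rho_0\ge r$ a.e. for some constant $r>0$. For $\theta\in\mathbb R^N$ consider the Bloch spectral cell problem, in the weak sense, for $\psi\in H^1(\mathbb T^N;\mathbb C)$, $\psi\neq 0$, $$-(\operatorname{div}_y+2i\pi\theta)\big(A_0(y)(\nabla_y+2i\pi\theta)\psi\big)=\lambda\,\rho_0(y)\,\psi\quad\text{in }\mathbb T^N ,$$ and let $\lambda_n(\theta)$ be its eigenvalues, labelled in increasing order and repeated according to multiplicity. Fix $\theta_0\in\mathbb R^N$ and an index $n$ such that $\lambda_n(\theta_0)$ is a simple eigenvalue and $\lambda_n(\theta_0)>0$. Let $\omega_n(\theta)\ge 0$ be the frequency defined by $4\pi^2\omega_n(\theta)^2=\lambda_n(\theta)$. Then $\lambda_n$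 and $\omega_n$ are differentiable at $\theta_0$, and the group velocity $$\mathcal V:=-\nabla_\theta\,\omega_n(\theta_0)=\frac{-\nabla_\theta\lambda_n(\theta_0)}{4\pi\sqrt{\lambda_n(\theta_0)}}$$ satisfies $$|\mathcal V|\le c_{\max},$$ where $|\cdot|$ is the Euclidean norm, $c_{\max}:=\operatorname{ess\,sup}_{y\in\mathbb T^N}c(y)$ is the maximal speed of propagation, and $c(y):=\max_{1\le j\le N}\sqrt{\lambda_j(y)}$ is the local speed of propagation, $\lambda_1(y),\dots,\lambda_N(y)$ being the roots $\lambda$ of $\det\big(A_0(y)-\lambda\rho_0(y)I\big)$. -/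

import Mathlib

open MeasureTheory

noncomputable section

/-- Infinitely differentiable complex functions on the unit torus `𝕋^N = ℝ^N / ℤ^N`: the
`ℤ^N`-periodic lift to `ℝ^N` is of class `C^∞`. -/
def IsTorusTestFunction {N : ℕ} (φ : UnitAddTorus (Fin N) → ℂ) : Prop :=
  ContDiff ℝ (⊤ : ℕ∞) (fun x : Fin N → ℝ => φ (fun i => (x i : UnitAddCircle)))

/-- The `j`-th partial derivative of a function on the unit torus. -/
def torusPartial {N : ℕ} (j : Fin N) (φ : UnitAddTorus (Fin N) → ℂ)
    (y : UnitAddTorus (Fin N)) : ℂ :=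
  deriv (fun t : ℝ => φ (y + Pi.single j (t : UnitAddCircle))) 0

/-- The complex Hilbert space `L²(𝕋^N)`. -/
abbrev TorusL2 (N : ℕ) : Type :=
  Lp ℂ 2 (volume : Measure (UnitAddTorus (Fin N)))

/-- `g` is the weak gradient of `u`, both being square integrable on the torus. Thus `u`
belongs to `H¹(𝕋^N)` exactly if it has a weak gradient. -/
def HasWeakGradient {N : ℕ} (u : TorusL2 N) (g : Fin N → TorusL2 N) : Prop :=
  ∀ φ : UnitAddTorus (Fin N) → ℂ, IsTorusTestFunction φ →
    ∀ j : Fin N, ∫ y, u y * torusPartial j φ y = -∫ y, g j y * φ y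

/-- The `j`-th component of the shifted gradient `(∇_y + 2iπθ) u`, where `g` is the weak
gradient of `u`. -/
def shiftedGradient {N : ℕ} (θ : EuclideanSpace ℝ (Fin N)) (u : TorusL2 N)
    (g : Fin N → TorusL2 N) (j : Fin N) (y : UnitAddTorus (Fin N)) : ℂ :=
  g j y + 2 * Complex.I * (Real.pi : ℂ) * (θ j : ℂ) * u y

/-- The sesquilinear form
`∫ A(y) (∇_y + 2iπθ) u · conj ((∇_y + 2iπθ) v) dy`,
where `g` and `h` are the weak gradients of `u` and `v`. -/
def blochForm {N : ℕ} (A : UnitAddTorus (Fin N) → Matrix (Fin N) (Fin N) ℝ)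
    (θ : EuclideanSpace ℝ (Fin N)) (u : TorusL2 N) (g : Fin N → TorusL2 N)
    (v : TorusL2 N) (h : Fin N → TorusL2 N) : ℂ :=
  ∫ y, ∑ i, ∑ j, (A y i j : ℂ) * shiftedGradient θ u g j y *
    (starRingEnd ℂ) (shiftedGradient θ v h i y)

/-- `ψ ∈ H¹(𝕋^N)` is an eigenfunction, with eigenvalue `μ`, of the Bloch cell problem
`-(div_y + 2iπθ) (A(y) (∇_y + 2iπθ) ψ) = μ ρ(y) ψ` in `𝕋^N`, in the weak sense: the equation
is tested against all functions in `H¹(𝕋^N)`. -/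
def IsBlochEigenfunction {N : ℕ} (A : UnitAddTorus (Fin N) → Matrix (Fin N) (Fin N) ℝ)
    (ρ : UnitAddTorus (Fin N) → ℝ) (θ : EuclideanSpace ℝ (Fin N)) (μ : ℝ)
    (ψ : TorusL2 N) : Prop :=
  ψ ≠ 0 ∧ ∃ g : Fin N → TorusL2 N, HasWeakGradient ψ g ∧
    ∀ (v : TorusL2 N) (h : Fin N → TorusL2 N), HasWeakGradient v h →
      blochForm A θ ψ g v h
        = (μ : ℂ) * ∫ y, (ρ y : ℂ) * ψ y * (starRingEnd ℂ) (v y)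

/-- The real number `μ` is a simple eigenvalue of the Bloch cell problem: there is an
eigenfunction, and it is unique up to a scalar factor. -/
def IsSimpleBlochEigenvalue {N : ℕ} (A : UnitAddTorus (Fin N) → Matrix (Fin N) (Fin N) ℝ)
    (ρ : UnitAddTorus (Fin N) → ℝ) (θ : EuclideanSpace ℝ (Fin N)) (μ : ℝ) : Prop :=
  ∃ ψ : TorusL2 N, IsBlochEigenfunction A ρ θ μ ψ ∧
    ∀ χ : TorusL2 N, IsBlochEigenfunction A ρ θ μ χ → ∃ c : ℂ, χ = c • ψ

/-- The eigenvalues of the Bloch cell problem, labelled in increasing order and repeated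
according to their multiplicity; the labels start at `n = 0`. The value is the least `Λ` such
that the eigenvalues `≤ Λ` have total multiplicity at least `n + 1`. -/
def blochEigenvalue {N : ℕ} (A : UnitAddTorus (Fin N) → Matrix (Fin N) (Fin N) ℝ)
    (ρ : UnitAddTorus (Fin N) → ℝ) (n : ℕ) (θ : EuclideanSpace ℝ (Fin N)) : ℝ :=
  sInf {Λ : ℝ | ∃ ψ : Fin (n + 1) → TorusL2 N, LinearIndependent ℂ ψ ∧
    ∀ k, ∃ μ ≤ Λ, IsBlochEigenfunction A ρ θ μ (ψ k)}

/-- The nonnegative frequency `ω_n` with `4 π² ω_n(θ)² = λ_n(θ)`. -/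
def blochFrequency {N : ℕ} (A : UnitAddTorus (Fin N) → Matrix (Fin N) (Fin N) ℝ)
    (ρ : UnitAddTorus (Fin N) → ℝ) (n : ℕ) (θ : EuclideanSpace ℝ (Fin N)) : ℝ :=
  Real.sqrt (blochEigenvalue A ρ n θ) / (2 * Real.pi)

/-- The group velocity `-∇_θ ω_n(θ)`. -/
def groupVelocity {N : ℕ} (A : UnitAddTorus (Fin N) → Matrix (Fin N) (Fin N) ℝ)
    (ρ : UnitAddTorus (Fin N) → ℝ) (n : ℕ) (θ : EuclideanSpace ℝ (Fin N)) :
    EuclideanSpace ℝ (Fin N) :=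
  -gradient (blochFrequency A ρ n) θ

/-- The local speed of propagation at `y`: the largest square root of a root `μ` of
`det (A(y) - μ ρ(y) I)`. -/
def localSpeed {N : ℕ} (A : UnitAddTorus (Fin N) → Matrix (Fin N) (Fin N) ℝ)
    (ρ : UnitAddTorus (Fin N) → ℝ) (y : UnitAddTorus (Fin N)) : ℝ :=
  sSup (Real.sqrt '' {μ : ℝ | (A y - (μ * ρ y) • (1 : Matrix (Fin N) (Fin N) ℝ)).det = 0})

/-- The maximal speed of propagation. As the coefficients are only defined almost everywhere,
the maximum over the torus is the essential supremum. -/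
def maxSpeed {N : ℕ} (A : UnitAddTorus (Fin N) → Matrix (Fin N) (Fin N) ℝ)
    (ρ : UnitAddTorus (Fin N) → ℝ) : ℝ :=
  essSup (localSpeed A ρ) volume

end

/-! ### Eigenvectors of a coercive pencil `K u = κ B u` with compact `B` -/

noncomputable section

section Pencil

open Filter Topology

variable {V : Type*} [NormedAddCommGroup V] [InnerProductSpace ℂ V]

/-! On `H¹(𝕋^N)` the weak cell problem is an operator pencil `T(θ) p = μ B p`. Here `T(θ) = D* 𝒜 D`
with `D = ∇ + 2iπθ`, and `B` represents the `ρ`-weighted `L²` product; `B` is compact by Rellich's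
theorem, and `T(θ) + C B` is coercive for some `C`.

Differentiability needs no analytic perturbation theory. The min-max principle
(`mem_pencilLevels_iff`) replaces eigenvectors by trial subspaces, so the `n`-th eigenvalue depends
continuously on the operator (`abs_sInf_pencilLevels_sub_le`). At a simple eigenvalue, compactness
forces normalised approximate eigenvectors close to the eigenvector `u₀`
(`approximate_eigenvector_near`). Pairing the equation at `θ` with `u₀` then gives the
Hellmann–Feynman formula (`hasFDerivAt_sInf_pencilLevels`). As `T(θ)` is quadratic in `θ`, it reads
`∇λ·τ = (2/b) Re ⟪2iπτ u₀, 𝒜 D u₀⟫` with `b = ∫ ρ |u₀|²`.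

The bound is Cauchy–Schwarz for the form of `𝒜`. One factor is `⟪D u₀, 𝒜 D u₀⟫ = λ b` by the
eigenvalue equation. The other is at most `(2π c_max |τ|)² b`, because `A τ·τ ≤ c_max² ρ |τ|²`
almost everywhere. So `|∇λ·τ| ≤ 4π √λ c_max |τ|`, and the chain rule for the square root divides by
`4π √λ`. -/

theorem exists_eigenvector_ge_of_isPositive [CompleteSpace V] {T : V →L[ℂ] V}
    (hT : IsCompactOperator T)
    (hpos : T.IsPositive) {w : V} (hw : w ≠ 0) {c : ℝ} (hc : 0 < c)
    (h : c * ‖w‖ ^ 2 ≤ (inner ℂ w (T w)).re) :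
    ∃ τ : ℝ, c ≤ τ ∧ ∃ x : V, x ≠ 0 ∧ T x = (τ : ℂ) • x := by
  have hnt : Nontrivial V := ⟨w, 0, hw⟩
  have hw' : 0 < ‖w‖ := norm_pos_iff.mpr hw
  have hcT : c ≤ ‖T‖ := by
    have h1 : (inner ℂ w (T w)).re ≤ ‖w‖ * (‖T‖ * ‖w‖) :=
      (Complex.re_le_norm _).trans ((norm_inner_le_norm _ _).trans (by gcongr; exact T.le_opNorm w))
    have : c * ‖w‖ ^ 2 ≤ ‖T‖ * ‖w‖ ^ 2 := by linarith
    exact le_of_mul_le_mul_right this (by positivity)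
  -- For positive `T` the norm is the supremum of the Rayleigh quotient; were it in the resolvent
  -- set, the quotient would stay below `‖T‖ - ε`. Compactness then turns this spectral value into
  -- an eigenvalue.
  have hspec : ((‖T‖ : ℝ) : ℂ) ∈ spectrum ℂ T := by
    by_contra hn
    have hr : algebraMap ℝ ℂ ‖T‖ ∈ resolventSet ℂ T := by
      simpa [spectrum] using hn
    obtain ⟨ε, hε, hle⟩ := T.rayleighQuotient_le_of_norm_mem_resolventSet hr
    have h2 := T.norm_eq_iSup_rayleighQuotient hpos.isSymmetric
    have h3 : (⨆ x, |T.rayleighQuotient x|) ≤ ‖T‖ - ε := by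
      refine ciSup_le fun x => ?_
      rw [abs_of_nonneg]
      · exact hle x
      · exact div_nonneg (hpos.re_inner_nonneg_left x) (by positivity)
    linarith
  have hne : ((‖T‖ : ℝ) : ℂ) ≠ 0 := by
    exact_mod_cast (hc.trans_le hcT).ne'
  have hev := (hT.hasEigenvalue_iff_mem_spectrum hne).mpr hspec
  obtain ⟨x, hx, hx0⟩ := hev.exists_hasEigenvector
  exact ⟨‖T‖, hcT, x, hx0, by simpa using hx⟩

/-- Restriction of a coercive symmetric pencil to the `B`-orthogonal complement of eigenvectors. -/
theorem exists_pencil_eigenvector_orthogonal [CompleteSpace V] {K B : V →L[ℂ] V}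
    (hK : K.IsPositive) {c : ℝ} (hc : 0 < c) (hcoer : ∀ u, c * ‖u‖ ^ 2 ≤ (inner ℂ u (K u)).re)
    (hB : B.IsPositive) (hBc : IsCompactOperator B) {ι : Type*} {e : ι → V} {κ : ι → ℝ}
    (hκ : ∀ k, κ k ≠ 0) (he : ∀ k, K (e k) = (κ k : ℂ) • B (e k)) {u : V} (hu : u ≠ 0)
    (hue : ∀ k, inner ℂ (e k) (B u) = 0) {Λ : ℝ}
    (hle : (inner ℂ u (K u)).re ≤ Λ * (inner ℂ u (B u)).re) :
    ∃ κ' ≤ Λ, ∃ x : V, x ≠ 0 ∧ K x = (κ' : ℂ) • B x ∧ ∀ k, inner ℂ (e k) (B x) = 0 := by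
  have hupos : 0 < ‖u‖ := norm_pos_iff.mpr hu
  have hKu : 0 < (inner ℂ u (K u)).re := lt_of_lt_of_le (by positivity) (hcoer u)
  have hBu : 0 ≤ (inner ℂ u (B u)).re := hB.re_inner_nonneg_right u
  have hΛ : 0 < Λ := by
    by_contra hn
    push Not at hn
    nlinarith
  -- With `S = K^{1/2}` and `x = S u`, the pencil becomes the ordinary problem `S⁻¹ B S⁻¹ x = κ⁻¹ x`
  -- for a compact positive operator. Eigenvalues `κ ≤ Λ` correspond to eigenvalues `τ ≥ Λ⁻¹`.
  set S : V →L[ℂ] V := CFC.sqrt K with hS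
  have hK0 : 0 ≤ K := (ContinuousLinearMap.nonneg_iff_isPositive K).mpr hK
  have hSS : S * S = K := CFC.sqrt_mul_sqrt_self K hK0
  have hSpos : S.IsPositive :=
    (ContinuousLinearMap.nonneg_iff_isPositive S).mp (CFC.sqrt_nonneg K)
  have hSsym : ∀ x y, inner ℂ (S x) y = inner ℂ x (S y) := fun x y => hSpos.isSymmetric x y
  have hKu : IsUnit K := by
    refine K.isUnit_of_forall_le_norm_inner_map (c := ⟨c, hc.le⟩) hc fun x => ?_
    calc ‖x‖ ^ 2 * c ≤ (inner ℂ x (K x)).re := by linarith [hcoer x]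
      _ ≤ ‖inner ℂ x (K x)‖ := Complex.re_le_norm _
      _ = ‖inner ℂ (K x) x‖ := norm_inner_symm _ _
  have hSu : IsUnit S := by
    rw [hS]; exact (CFC.isUnit_sqrt_iff K).mpr hKu
  obtain ⟨R, hRS, hSR⟩ : ∃ R : V →L[ℂ] V, R * S = 1 ∧ S * R = 1 :=
    ⟨↑hSu.unit⁻¹, hSu.val_inv_mul, hSu.mul_val_inv⟩
  have hRS' : ∀ x, R (S x) = x := fun x => congrArg (fun f : V →L[ℂ] V => f x) hRS
  have hSR' : ∀ x, S (R x) = x := fun x => congrArg (fun f : V →L[ℂ] V => f x) hSR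
  have hSS' : ∀ x, S (S x) = K x := fun x => congrArg (fun f : V →L[ℂ] V => f x) hSS
  have hRsym : ∀ x y, inner ℂ (R x) y = inner ℂ x (R y) := fun x y => by
    conv_lhs => rw [← hSR' y, ← hSsym, hSR']
  set T : V →L[ℂ] V := R ∘L B ∘L R with hTdef
  have hTapp : ∀ x, T x = R (B (R x)) := fun _ => rfl
  have hTinner : ∀ x y, inner ℂ x (T y) = inner ℂ (R x) (B (R y)) := fun x y => by
    rw [hTapp, ← hRsym]
  -- Since `S (S e_k) = κ_k B e_k` with `κ_k ≠ 0`, orthogonality to `S e_k` is `B`-orthogonality of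
  -- `S⁻¹ x` to `e_k`. This makes `X` invariant under `T`.
  set X : Submodule ℂ V := ⨅ k, (Submodule.span ℂ {S (e k)})ᗮ with hX
  have hXmem : ∀ x, x ∈ X ↔ ∀ k, inner ℂ (S (e k)) x = 0 := fun x => by
    simp [hX, Submodule.mem_iInf, Submodule.mem_orthogonal_singleton_iff_inner_right]
  have hXe : ∀ x, x ∈ X ↔ ∀ k, inner ℂ (e k) (B (R x)) = 0 := fun x => by
    rw [hXmem]
    refine forall_congr' fun k => ?_
    have : inner ℂ (S (e k)) x = (κ k : ℂ) * inner ℂ (e k) (B (R x)) := by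
      conv_lhs => rw [← hSR' x, ← hSsym, hSS', he, inner_smul_left]
      rw [Complex.conj_ofReal, hB.inner_left_eq_inner_right]
    rw [this]
    simp [hκ k]
  have hXcl : IsClosed (X : Set V) := by
    rw [hX, Submodule.coe_iInf]
    exact isClosed_iInter fun k => Submodule.isClosed_orthogonal _
  have : CompleteSpace X := hXcl.completeSpace_coe
  have hTX : ∀ x ∈ X, T x ∈ X := fun x hx => by
    rw [hXmem]
    intro k
    rw [hTinner, hRS']
    exact (hXe x).mp hx k
  have hTsym : T.IsSymmetric := fun x y => by
    change inner ℂ (T x) y = inner ℂ x (T y)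
    rw [hTinner, hTapp, hRsym]
    exact hB.isSymmetric _ _
  set T' : X →L[ℂ] X := T.restrict hTX with hT'
  have hT'app : ∀ x : X, ((T' x : X) : V) = T x := fun _ => rfl
  have hTc : IsCompactOperator T := (hBc.comp_clm R).clm_comp R
  have hT'c : IsCompactOperator T' := hTc.restrict' hTX
  have hT'pos : T'.IsPositive := by
    refine (ContinuousLinearMap.isPositive_iff_complex _).mpr fun x => ?_
    have h1 : inner ℂ (T' x) x = inner ℂ (B (R x)) (R x) := by
      rw [Submodule.coe_inner, hT'app, hTapp, hRsym]
    rw [h1]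
    exact (ContinuousLinearMap.isPositive_iff_complex _).mp hB (R x)
  have hSuX : S u ∈ X := (hXe _).mpr fun k => by rw [hRS']; exact hue k
  have hwne : (⟨S u, hSuX⟩ : X) ≠ 0 := by
    intro h0
    have : S u = 0 := congrArg Subtype.val h0
    exact hu (by rw [← hRS' u, this, map_zero])
  have hnorm : ‖S u‖ ^ 2 = (inner ℂ u (K u)).re := by
    rw [← hSS', ← hSsym, inner_self_eq_norm_sq_to_K]
    norm_cast
  obtain ⟨τ, hτ, ⟨x, hxX⟩, hx0, hx⟩ := exists_eigenvector_ge_of_isPositive hT'c hT'pos hwne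
    (inv_pos.mpr hΛ) (by
      rw [Submodule.coe_inner, hT'app]
      simp only [Submodule.coe_norm]
      rw [hTinner, hRS', hnorm, inv_mul_le_iff₀ hΛ]
      exact hle)
  have hτ0 : 0 < τ := lt_of_lt_of_le (inv_pos.mpr hΛ) hτ
  have hxV : T x = (τ : ℂ) • x := congrArg Subtype.val hx
  refine ⟨τ⁻¹, inv_le_of_inv_le₀ hΛ hτ, R x, ?_, ?_, ?_⟩
  · intro h0
    apply hx0
    ext
    change x = 0
    rw [← hSR' x, h0, map_zero]
  · have h1 : B (R x) = (τ : ℂ) • S x := by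
      rw [← map_smul, ← hxV, hTapp, hSR']
    rw [← hSS', hSR', h1, smul_smul]
    have : ((τ⁻¹ : ℝ) : ℂ) * (τ : ℂ) = 1 := by
      rw [← Complex.ofReal_mul, inv_mul_cancel₀ hτ0.ne']; simp
    rw [this, one_smul]
  · exact (hXe x).mp hxX

end Pencil

end

/-! ### The min-max principle and Lipschitz dependence of eigenvalues -/

noncomputable section

section Pencil

open Filter Topology

variable {V : Type*} [NormedAddCommGroup V] [InnerProductSpace ℂ V]

/-- Dimension count: `j` linear conditions on an `m`-dimensional space with `j < m` have a nonzero
common solution. It supplies the trial vectors for min-max. -/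
theorem exists_mem_span_ne_zero_orthogonal (B : V →L[ℂ] V) {m j : ℕ} (hjm : j < m)
    {w : Fin m → V} (hw : LinearIndependent ℂ w) (e : Fin j → V) :
    ∃ u ∈ Submodule.span ℂ (Set.range w), u ≠ 0 ∧ ∀ k, inner ℂ (e k) (B u) = 0 := by
  set f : (Fin m → ℂ) →ₗ[ℂ] (Fin j → ℂ) :=
    LinearMap.pi (fun k => (innerSL ℂ (e k) : V →ₗ[ℂ] ℂ) ∘ₗ (B : V →ₗ[ℂ] V)
      ∘ₗ Fintype.linearCombination ℂ w) with hf
  have hker : LinearMap.ker f ≠ ⊥ := LinearMap.ker_ne_bot_of_finrank_lt (by simpa using hjm)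
  obtain ⟨c, hc, hc0⟩ := (Submodule.ne_bot_iff _).mp hker
  refine ⟨Fintype.linearCombination ℂ w c, ?_, ?_, fun k => ?_⟩
  · rw [Fintype.linearCombination_apply]
    exact Submodule.sum_mem _ fun i _ => Submodule.smul_mem _ _ (Submodule.subset_span ⟨i, rfl⟩)
  · intro h0
    exact hc0 (funext fun i => Fintype.linearIndependent_iff.mp hw c
      (by rwa [Fintype.linearCombination_apply] at h0) i)
  · exact congrFun (LinearMap.mem_ker.mp hc) k

/-- The hard half of min-max. Eigenvectors are extracted one at a time: while fewer than `m` are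
known, the trial space contains a nonzero vector `B`-orthogonal to them, which forces a further
eigenvalue `≤ Λ` on their `B`-orthogonal complement. -/
theorem exists_linearIndependent_pencil_eigenvectors [CompleteSpace V] {K B : V →L[ℂ] V}
    (hK : K.IsPositive) {c : ℝ} (hc : 0 < c) (hcoer : ∀ u, c * ‖u‖ ^ 2 ≤ (inner ℂ u (K u)).re)
    (hB : B.IsPositive) (hBc : IsCompactOperator B) {m : ℕ} {w : Fin m → V}
    (hw : LinearIndependent ℂ w) {Λ : ℝ}
    (hle : ∀ u ∈ Submodule.span ℂ (Set.range w),
      (inner ℂ u (K u)).re ≤ Λ * (inner ℂ u (B u)).re) :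
    ∃ ψ : Fin m → V, LinearIndependent ℂ ψ ∧ ∀ k, ∃ κ ≤ Λ, K (ψ k) = (κ : ℂ) • B (ψ k) := by
  suffices H : ∀ j ≤ m, ∃ ψ : Fin j → V, LinearIndependent ℂ ψ ∧
      ∀ k, ∃ κ ≤ Λ, K (ψ k) = (κ : ℂ) • B (ψ k) from H m le_rfl
  intro j
  induction j with
  | zero => exact fun _ => ⟨Fin.elim0, linearIndependent_empty_type, fun k => k.elim0⟩
  | succ j ih =>
    intro hj
    obtain ⟨ψ, hψ, hev⟩ := ih (by omega)
    choose κ hκ hψκ using hev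
    obtain ⟨u, huw, hu0, hue⟩ := exists_mem_span_ne_zero_orthogonal B (Nat.lt_of_succ_le hj) hw ψ
    have hpos : ∀ x : V, x ≠ 0 → 0 < (inner ℂ x (K x)).re := fun x hx =>
      lt_of_lt_of_le (mul_pos hc (pow_pos (norm_pos_iff.mpr hx) 2)) (hcoer x)
    have hκ0 : ∀ k, κ k ≠ 0 := fun k h0 => by
      have := hpos (ψ k) (hψ.ne_zero k)
      rw [hψκ, h0] at this
      simp at this
    obtain ⟨κ', hκ', x, hx0, hx, hxe⟩ := exists_pencil_eigenvector_orthogonal hK hc hcoer hB hBc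
      hκ0 hψκ hu0 hue (hle u huw)
    refine ⟨Fin.snoc ψ x, hψ.finSnoc ?_, ?_⟩
    -- If `x` lay in the span of the earlier eigenvectors, then `⟪x, B x⟫ = 0`, whereas `⟪x, K x⟫ =
    -- κ' ⟪x, B x⟫` is positive.
    · intro hmem
      have h1 : ∀ y ∈ Submodule.span ℂ (Set.range ψ), inner ℂ y (B x) = 0 := by
        intro y hy
        induction hy using Submodule.span_induction with
        | mem y hy => obtain ⟨k, rfl⟩ := hy; exact hxe k
        | zero => simp
        | add y z _ _ hy hz => rw [inner_add_left, hy, hz, add_zero]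
        | smul a y _ hy => rw [inner_smul_left, hy, mul_zero]
      have h2 := hpos x hx0
      rw [hx, inner_smul_right, h1 x hmem] at h2
      simp at h2
    · intro k
      refine Fin.lastCases ?_ (fun k => ?_) k
      · exact ⟨κ', hκ', by simpa using hx⟩
      · exact ⟨κ k, hκ k, by simpa using hψκ k⟩

/-- The easy half of min-max. Eigenvectors with distinct eigenvalues are `B`-orthogonal, so no
orthogonalisation inside eigenspaces is needed: for `u = ∑ c_k ψ_k`, the difference `Λ ⟪u, B u⟫ -
⟪u, K u⟫` is the `B`-form at `∑ √(Λ - κ_k) c_k ψ_k`, hence nonnegative. -/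
theorem re_inner_le_of_mem_span_eigenvectors {K B : V →L[ℂ] V}
    (hK : K.IsSymmetric) (hB : B.IsPositive) {m : ℕ} {ψ : Fin m → V} {Λ : ℝ}
    (hψ : ∀ k, ∃ κ ≤ Λ, K (ψ k) = ((κ : ℝ) : ℂ) • B (ψ k)) {u : V}
    (hu : u ∈ Submodule.span ℂ (Set.range ψ)) :
    (inner ℂ u (K u)).re ≤ Λ * (inner ℂ u (B u)).re := by
  choose κ hκ hψκ using hψ
  obtain ⟨c, rfl⟩ := (Submodule.mem_span_range_iff_exists_fun ℂ).mp hu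
  have horth : ∀ k l, κ k ≠ κ l → inner ℂ (ψ k) (B (ψ l)) = 0 := by
    intro k l hkl
    have h1 : inner ℂ (K (ψ k)) (ψ l) = inner ℂ (ψ k) (K (ψ l)) := hK _ _
    rw [hψκ, hψκ, inner_smul_left, inner_smul_right, Complex.conj_ofReal,
      hB.inner_left_eq_inner_right, ← sub_eq_zero, ← sub_mul] at h1
    refine (mul_eq_zero.mp h1).resolve_left ?_
    rw [← Complex.ofReal_sub]
    exact_mod_cast sub_ne_zero.mpr hkl
  set s : Fin m → ℝ := fun k => Real.sqrt (Λ - κ k)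
  have hs : ∀ k, s k * s k = Λ - κ k := fun k => Real.mul_self_sqrt (by linarith [hκ k])
  have key : (Λ : ℂ) * inner ℂ (∑ i, c i • ψ i) (B (∑ i, c i • ψ i))
      - inner ℂ (∑ i, c i • ψ i) (K (∑ i, c i • ψ i))
      = inner ℂ (∑ i, ((s i : ℂ) * c i) • ψ i) (B (∑ i, ((s i : ℂ) * c i) • ψ i)) := by
    simp only [map_sum, map_smul, sum_inner, inner_sum, inner_smul_left, inner_smul_right, hψκ,
      Finset.mul_sum, ← Finset.sum_sub_distrib, map_mul, Complex.conj_ofReal]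
    refine Finset.sum_congr rfl fun k _ => Finset.sum_congr rfl fun l _ => ?_
    by_cases hkl : κ k = κ l
    · have h2 : (s k : ℂ) * (s l : ℂ) = Λ - κ k := by
        have : s l = s k := by simp only [s, hkl]
        rw [this, ← Complex.ofReal_mul, hs]
        simp
      linear_combination (-c k * (starRingEnd ℂ) (c l) * inner ℂ (ψ l) (B (ψ k))) * h2
    · rw [horth l k (Ne.symm hkl)]; ring
  have h3 := congrArg Complex.re key
  have h4 := hB.re_inner_nonneg_right (∑ i, ((s i : ℂ) * c i) • ψ i)
  rw [Complex.sub_re, Complex.re_ofReal_mul] at h3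
  change 0 ≤ (inner ℂ _ _ : ℂ).re at h4
  linarith

/-- A positive form `T` and a positive compact form `B` such that `T + C B` is coercive. -/
structure IsCoercivePencil (T B : V →L[ℂ] V) (C c : ℝ) : Prop where
  left_pos : T.IsPositive
  right_pos : B.IsPositive
  right_compact : IsCompactOperator B
  shift_nonneg : 0 ≤ C
  const_pos : 0 < c
  coercive : ∀ u, c * ‖u‖ ^ 2 ≤ (inner ℂ u (T u)).re + C * (inner ℂ u (B u)).re

/-- The reals `Λ` such that the eigenvalues `≤ Λ` of `T u = μ B u` have total multiplicity
at least `m`. -/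
def pencilLevels (T B : V →L[ℂ] V) (m : ℕ) : Set ℝ :=
  {Λ | ∃ ψ : Fin m → V, LinearIndependent ℂ ψ ∧ ∀ k, ∃ μ ≤ Λ, T (ψ k) = (μ : ℂ) • B (ψ k)}

namespace IsCoercivePencil

variable {T T₁ B : V →L[ℂ] V} {C C₁ c c₁ : ℝ}

theorem shift_isPositive (h : IsCoercivePencil T B C c) : (T + (C : ℂ) • B).IsPositive :=
  h.left_pos.add (h.right_pos.smul_of_nonneg (by exact_mod_cast h.shift_nonneg))

theorem re_inner_shift (T B : V →L[ℂ] V) (C : ℝ) (u : V) :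
    (inner ℂ u ((T + (C : ℂ) • B) u)).re = (inner ℂ u (T u)).re + C * (inner ℂ u (B u)).re := by
  rw [add_apply, smul_apply, inner_add_right, inner_smul_right, Complex.add_re,
    Complex.re_ofReal_mul]

theorem inner_right_pos (h : IsCoercivePencil T B C c) {u : V} (hu : u ≠ 0) {μ : ℝ}
    (hT : T u = (μ : ℂ) • B u) : 0 < (inner ℂ u (B u)).re := by
  have h1 : 0 ≤ (inner ℂ u (B u)).re := h.right_pos.re_inner_nonneg_right u
  refine h1.lt_of_ne fun h0 => ?_
  have h2 := h.coercive u
  rw [hT, inner_smul_right, Complex.re_ofReal_mul, ← h0] at h2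
  have h3 := mul_pos h.const_pos (pow_pos (norm_pos_iff.mpr hu) 2)
  linarith

theorem eigenvalue_nonneg (h : IsCoercivePencil T B C c) {u : V} (hu : u ≠ 0) {μ : ℝ}
    (hT : T u = (μ : ℂ) • B u) : 0 ≤ μ := by
  have h1 := h.inner_right_pos hu hT
  have h2 : 0 ≤ (inner ℂ u (T u)).re := h.left_pos.re_inner_nonneg_right u
  rw [hT, inner_smul_right, Complex.re_ofReal_mul] at h2
  exact nonneg_of_mul_nonneg_left h2 h1

theorem nonneg_of_mem_pencilLevels (h : IsCoercivePencil T B C c) {n : ℕ} {Λ : ℝ}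
    (hΛ : Λ ∈ pencilLevels T B (n + 1)) : 0 ≤ Λ := by
  obtain ⟨ψ, hψ, hev⟩ := hΛ
  obtain ⟨μ, hμ, hT⟩ := hev 0
  exact (h.eigenvalue_nonneg (hψ.ne_zero 0) hT).trans hμ

theorem bddBelow_pencilLevels (h : IsCoercivePencil T B C c) (n : ℕ) :
    BddBelow (pencilLevels T B (n + 1)) :=
  ⟨0, fun _ hΛ => h.nonneg_of_mem_pencilLevels hΛ⟩

/-- Courant–Fischer, by applying the two halves with the shift `K = T + C B`, which moves
eigenvalues by `C`. The right-hand side mentions no eigenvectors, so two pencils can be compared on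
one trial space. -/
theorem mem_pencilLevels_iff [CompleteSpace V] (h : IsCoercivePencil T B C c) {m : ℕ} {Λ : ℝ} :
    Λ ∈ pencilLevels T B m ↔ ∃ w : Fin m → V, LinearIndependent ℂ w ∧
      ∀ u ∈ Submodule.span ℂ (Set.range w),
        (inner ℂ u (T u)).re ≤ Λ * (inner ℂ u (B u)).re := by
  constructor
  · rintro ⟨ψ, hψ, hev⟩
    exact ⟨ψ, hψ, fun u hu =>
      re_inner_le_of_mem_span_eigenvectors h.left_pos.isSymmetric h.right_pos hev hu⟩
  · rintro ⟨w, hw, hle⟩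
    obtain ⟨ψ, hψ, hev⟩ := exists_linearIndependent_pencil_eigenvectors h.shift_isPositive
      h.const_pos (fun u => by rw [re_inner_shift]; exact h.coercive u) h.right_pos
      h.right_compact hw (Λ := Λ + C) (fun u hu => by
        rw [re_inner_shift]; linarith [hle u hu])
    refine ⟨ψ, hψ, fun k => ?_⟩
    obtain ⟨κ, hκ, hk⟩ := hev k
    refine ⟨κ - C, by linarith, ?_⟩
    rw [add_apply, smul_apply] at hk
    rw [Complex.ofReal_sub, sub_smul, ← hk, add_sub_cancel_right]

theorem abs_re_inner_le (h : IsCoercivePencil T B C c) (D : V →L[ℂ] V) (u : V) :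
    |(inner ℂ u (D u)).re| ≤
      ‖D‖ / c * ((inner ℂ u (T u)).re + C * (inner ℂ u (B u)).re) := by
  have h1 : |(inner ℂ u (D u)).re| ≤ ‖D‖ * ‖u‖ ^ 2 := by
    refine (Complex.abs_re_le_norm _).trans ((norm_inner_le_norm _ _).trans ?_)
    have := D.le_opNorm u
    have h0 := norm_nonneg u
    nlinarith
  refine h1.trans ?_
  rw [div_mul_eq_mul_div, le_div_iff₀ h.const_pos]
  have := mul_le_mul_of_nonneg_left (h.coercive u) (norm_nonneg D)
  linarith

theorem add_mem_pencilLevels [CompleteSpace V] (h : IsCoercivePencil T B C c)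
    (h₁ : IsCoercivePencil T₁ B C₁ c₁) {n : ℕ}
    {Λ : ℝ} (hΛ : Λ ∈ pencilLevels T B n) :
    Λ + ‖T₁ - T‖ / c * (Λ + C) ∈ pencilLevels T₁ B n := by
  rw [h.mem_pencilLevels_iff] at hΛ
  rw [h₁.mem_pencilLevels_iff]
  obtain ⟨w, hw, hle⟩ := hΛ
  refine ⟨w, hw, fun u hu => ?_⟩
  have h1 := (abs_le.mp (h.abs_re_inner_le (T₁ - T) u)).2
  rw [sub_apply, inner_sub_right, Complex.sub_re] at h1
  have h2 : 0 ≤ ‖T₁ - T‖ / c := div_nonneg (norm_nonneg _) h.const_pos.le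
  have h3 := mul_le_mul_of_nonneg_left (hle u hu) h2
  nlinarith [hle u hu]

/-- On a fixed trial space, `(1 - ε) ⟪u, T u⟫ ≤ ⟪u, T₁ u⟫ + ε C ⟪u, B u⟫` with `ε = ‖T₁ - T‖ / c`.
The estimate involves only the constants of `T`, so it is uniform in nearby `T₁`. -/
theorem div_mem_pencilLevels [CompleteSpace V] (h : IsCoercivePencil T B C c)
    (h₁ : IsCoercivePencil T₁ B C₁ c₁) (hε : ‖T₁ - T‖ / c < 1) {n : ℕ}
    {Λ : ℝ} (hΛ : Λ ∈ pencilLevels T₁ B n) :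
    (Λ + ‖T₁ - T‖ / c * C) / (1 - ‖T₁ - T‖ / c) ∈ pencilLevels T B n := by
  rw [h₁.mem_pencilLevels_iff] at hΛ
  rw [h.mem_pencilLevels_iff]
  obtain ⟨w, hw, hle⟩ := hΛ
  refine ⟨w, hw, fun u hu => ?_⟩
  have h1 := (abs_le.mp (h.abs_re_inner_le (T₁ - T) u)).1
  rw [sub_apply, inner_sub_right, Complex.sub_re] at h1
  rw [div_mul_eq_mul_div, le_div_iff₀ (by linarith)]
  nlinarith [hle u hu]

/-- Lipschitz dependence of the eigenvalues of a pencil on the operator. -/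
theorem abs_sInf_pencilLevels_sub_le [CompleteSpace V] (h : IsCoercivePencil T B C c)
    (h₁ : IsCoercivePencil T₁ B C₁ c₁) (hε : ‖T₁ - T‖ / c < 1) {n : ℕ}
    (hne : (pencilLevels T B (n + 1)).Nonempty) :
    |sInf (pencilLevels T₁ B (n + 1)) - sInf (pencilLevels T B (n + 1))| ≤
      ‖T₁ - T‖ / c * (sInf (pencilLevels T B (n + 1)) + C) := by
  set ε := ‖T₁ - T‖ / c with hεdef
  have hε0 : 0 ≤ ε := div_nonneg (norm_nonneg _) h.const_pos.le
  set l := sInf (pencilLevels T B (n + 1)) with hl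
  set l₁ := sInf (pencilLevels T₁ B (n + 1)) with hl₁
  have hne₁ : (pencilLevels T₁ B (n + 1)).Nonempty := by
    obtain ⟨Λ, hΛ⟩ := hne
    exact ⟨_, h.add_mem_pencilLevels h₁ hΛ⟩
  rw [abs_le]
  constructor
  · have h2 : l * (1 - ε) - ε * C ≤ l₁ := by
      refine le_csInf hne₁ fun Λ hΛ => ?_
      have h3 := csInf_le (h.bddBelow_pencilLevels n) (h.div_mem_pencilLevels h₁ hε hΛ)
      rw [← hl, ← hεdef, le_div_iff₀ (by linarith)] at h3
      linarith
    linarith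
  · have h2 : (l₁ - ε * C) / (1 + ε) ≤ l := by
      refine le_csInf hne fun Λ hΛ => ?_
      have h3 := csInf_le (h₁.bddBelow_pencilLevels n) (h.add_mem_pencilLevels h₁ hΛ)
      rw [← hl₁, ← hεdef] at h3
      rw [div_le_iff₀ (by linarith)]
      linarith
    rw [div_le_iff₀ (by linarith)] at h2
    linarith

/-- A near-optimal level suffices, so the infimum need not be shown to be attained. The largest
eigenvalue in a family witnessing such a level is itself a level, which bounds it below by the
infimum. -/
theorem exists_eigenvector_near_sInf (T B : V →L[ℂ] V) {n : ℕ}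
    (hne : (pencilLevels T B (n + 1)).Nonempty)
    (hbdd : BddBelow (pencilLevels T B (n + 1))) {δ : ℝ} (hδ : 0 < δ) :
    ∃ μ : ℝ, |μ - sInf (pencilLevels T B (n + 1))| ≤ δ ∧ ∃ u : V, u ≠ 0 ∧
      T u = (μ : ℂ) • B u := by
  obtain ⟨Λ, ⟨ψ, hψ, hev⟩, hΛ⟩ := exists_lt_of_csInf_lt hne (lt_add_of_pos_right _ hδ)
  choose μ hμ hT using hev
  obtain ⟨k, hk⟩ := Finite.exists_max μ
  have h1 : μ k ∈ pencilLevels T B (n + 1) := ⟨ψ, hψ, fun j => ⟨μ j, hk j, hT j⟩⟩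
  refine ⟨μ k, ?_, ψ k, hψ.ne_zero k, hT k⟩
  rw [abs_le]
  constructor
  · linarith [csInf_le hbdd h1]
  · linarith [hμ k]

end IsCoercivePencil

end Pencil

end

/-! ### Differentiability of a simple eigenvalue -/

noncomputable section

section Pencil

open Filter Topology

variable {V : Type*} [NormedAddCommGroup V] [InnerProductSpace ℂ V] [CompleteSpace V]

/-- Approximate eigenvectors for a simple eigenvalue, normalised by `⟨B u₀, u⟩ = ⟨B u₀, u₀⟩`,
are close to the eigenvector `u₀`. -/
theorem IsCoercivePencil.approximate_eigenvector_near {T B : V →L[ℂ] V} {C c : ℝ}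
    (h : IsCoercivePencil T B C c) {l : ℝ} {u₀ : V}
    (hu₀ : u₀ ≠ 0) (hT : T u₀ = (l : ℂ) • B u₀)
    (hsimple : ∀ u, T u = (l : ℂ) • B u → ∃ a : ℂ, u = a • u₀) {ε : ℝ} (hε : 0 < ε) :
    ∃ δ > 0, ∀ u : V, u ≠ 0 → ‖T u - (l : ℂ) • B u‖ ≤ δ * ‖u‖ →
      ∃ a : ℂ, a ≠ 0 ∧ inner ℂ (B u₀) (a • u) = inner ℂ (B u₀) u₀ ∧ ‖a • u - u₀‖ ≤ ε := by
  -- Otherwise there are unit vectors with residuals tending to zero, none of whose normalised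
  -- multiples comes within `ε` of `u₀`. A subsequence will converge to a unit eigenvector,
  -- contradicting simplicity.
  by_contra! hcon
  have hex : ∀ n : ℕ, ∃ u : V, ‖u‖ = 1 ∧ ‖T u - (l : ℂ) • B u‖ ≤ 1 / ((n : ℝ) + 1) ∧
      ∀ a : ℂ, a ≠ 0 → inner ℂ (B u₀) (a • u) = inner ℂ (B u₀) u₀ → ε < ‖a • u - u₀‖ := by
    intro n
    obtain ⟨u, hu, h1, h2⟩ := hcon (1 / ((n : ℝ) + 1)) (by positivity)
    have hnu : (‖u‖ : ℂ) ≠ 0 := by exact_mod_cast norm_ne_zero_iff.mpr hu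
    have hnu' : 0 < ‖u‖ := norm_pos_iff.mpr hu
    refine ⟨(‖u‖ : ℂ)⁻¹ • u, norm_smul_inv_norm hu, ?_, fun a ha h3 => ?_⟩
    · have : T ((‖u‖ : ℂ)⁻¹ • u) - (l : ℂ) • B ((‖u‖ : ℂ)⁻¹ • u)
          = (‖u‖ : ℂ)⁻¹ • (T u - (l : ℂ) • B u) := by
        rw [map_smul, map_smul, smul_sub, smul_comm]
      rw [this, norm_smul, norm_inv, Complex.norm_real, norm_norm, inv_mul_le_iff₀ hnu']
      linarith
    · rw [smul_smul] at h3 ⊢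
      exact h2 _ (mul_ne_zero ha (inv_ne_zero hnu)) h3
  choose u hu1 hres hfar using hex
  set K := T + (C : ℂ) • B with hKdef
  have hKapp : ∀ x, K x = T x + (C : ℂ) • B x := fun x => rfl
  obtain ⟨S, hS, hBS⟩ := h.right_compact.image_closedBall_subset_compact 1
  obtain ⟨z, -, φ, hφ, hz⟩ := hS.tendsto_subseq (x := fun n => B (u n)) fun n =>
    hBS ⟨u n, by simp [hu1 n], rfl⟩
  have hres0 : Tendsto (fun n => T (u n) - (l : ℂ) • B (u n)) atTop (𝓝 0) :=
    squeeze_zero_norm hres tendsto_one_div_add_atTop_nhds_zero_nat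
  -- `K u_n` is the residual plus `(l + C) B u_n`, and `B u_n` converges along the subsequence.
  -- Since `K` is bounded below, `u_n` is then Cauchy.
  have hKu : Tendsto (fun n => K (u (φ n))) atTop (𝓝 (0 + ((l + C : ℝ) : ℂ) • z)) := by
    refine ((hres0.comp hφ.tendsto_atTop).add (hz.const_smul ((l + C : ℝ) : ℂ))).congr fun n => ?_
    simp only [Function.comp_apply, hKapp, Complex.ofReal_add, add_smul]
    abel
  have hKbound : ∀ x, c * ‖x‖ ≤ ‖K x‖ := by
    intro x
    by_cases hx : x = 0
    · simp [hx]
    have h1 : c * ‖x‖ ^ 2 ≤ ‖x‖ * ‖K x‖ := by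
      refine (h.coercive x).trans ?_
      rw [← IsCoercivePencil.re_inner_shift]
      exact (Complex.re_le_norm _).trans (norm_inner_le_norm _ _)
    have hx' : 0 < ‖x‖ := norm_pos_iff.mpr hx
    nlinarith
  have hanti : AntilipschitzWith (Real.toNNReal c⁻¹) K :=
    K.antilipschitz_of_bound fun x => by
      rw [Real.coe_toNNReal _ (inv_pos.mpr h.const_pos).le, ← div_eq_inv_mul,
        le_div_iff₀ h.const_pos]
      linarith [hKbound x]
  have hcauchy : CauchySeq (fun n => u (φ n)) := by
    refine (hanti.isUniformInducing K.uniformContinuous).cauchy_map_iff.mp ?_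
    rw [Filter.map_map]
    exact hKu.cauchySeq
  obtain ⟨v, hv⟩ := cauchySeq_tendsto_of_complete hcauchy
  have hv1 : ‖v‖ = 1 := tendsto_nhds_unique hv.norm (by simp [hu1])
  have hveig : T v = (l : ℂ) • B v := by
    rw [← sub_eq_zero]
    refine tendsto_nhds_unique ?_ (hres0.comp hφ.tendsto_atTop)
    exact ((T.continuous.tendsto v).comp hv).sub (((B.continuous.tendsto v).comp hv).const_smul _)
  obtain ⟨a, ha⟩ := hsimple v hveig
  have ha0 : a ≠ 0 := by
    rintro rfl
    simp [ha] at hv1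
  set b := inner ℂ (B u₀) u₀ with hb
  have hb0 : b ≠ 0 := by
    have h1 := h.inner_right_pos hu₀ hT
    intro h0
    rw [← h.right_pos.inner_left_eq_inner_right, ← hb, h0] at h1
    simp at h1
  have hlim : Tendsto (fun n => inner ℂ (B u₀) (u (φ n))) atTop (𝓝 (a * b)) := by
    have := (tendsto_const_nhds (x := B u₀)).inner (𝕜 := ℂ) hv
    rwa [ha, inner_smul_right] at this
  have hlim2 : Tendsto (fun n => (b / inner ℂ (B u₀) (u (φ n))) • u (φ n)) atTop (𝓝 u₀) := by
    have := ((tendsto_const_nhds (x := b)).div hlim (mul_ne_zero ha0 hb0)).smul hv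
    rwa [ha, smul_smul, show b / (a * b) * a = 1 by field_simp, one_smul] at this
  have hne : ∀ᶠ n in atTop, inner ℂ (B u₀) (u (φ n)) ≠ 0 :=
    hlim.eventually_ne (mul_ne_zero ha0 hb0)
  have hclose : ∀ᶠ n in atTop, ‖(b / inner ℂ (B u₀) (u (φ n))) • u (φ n) - u₀‖ < ε := by
    have := (Metric.tendsto_nhds.mp hlim2) ε hε
    simpa [dist_eq_norm] using this
  obtain ⟨n, hn1, hn2⟩ := (hne.and hclose).exists
  refine (hfar (φ n) _ (div_ne_zero hb0 hn1) ?_).not_gt hn2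
  rw [inner_smul_right, div_mul_cancel₀ _ hn1]

/-- The `n`-th eigenvalue of a coercive pencil `T θ u = μ B u` is differentiable where it is
simple, and its derivative is given by the Hellmann–Feynman formula. -/
theorem hasFDerivAt_sInf_pencilLevels {Θ : Type*} [NormedAddCommGroup Θ] [NormedSpace ℝ Θ]
    {T : Θ → V →L[ℂ] V} {B : V →L[ℂ] V} (hpencil : ∀ θ, ∃ C c, IsCoercivePencil (T θ) B C c)
    {θ₀ : Θ} {L : Θ → V →L[ℂ] V} {M : ℝ} (hL : ∀ τ, ‖L τ‖ ≤ M * ‖τ‖)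
    (hT : (fun θ => T θ - T θ₀ - L (θ - θ₀)) =o[𝓝 θ₀] fun θ => θ - θ₀) {n : ℕ}
    (hne : (pencilLevels (T θ₀) B (n + 1)).Nonempty) {u₀ : V} (hu₀ : u₀ ≠ 0)
    (hTu₀ : T θ₀ u₀ = ((sInf (pencilLevels (T θ₀) B (n + 1)) : ℝ) : ℂ) • B u₀)
    (hsimple : ∀ u, T θ₀ u = ((sInf (pencilLevels (T θ₀) B (n + 1)) : ℝ) : ℂ) • B u →
      ∃ a : ℂ, u = a • u₀)
    {ℓ : Θ →L[ℝ] ℝ} (hℓ : ∀ τ, ℓ τ * (inner ℂ u₀ (B u₀)).re = (inner ℂ u₀ (L τ u₀)).re) :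
    HasFDerivAt (fun θ => sInf (pencilLevels (T θ) B (n + 1))) ℓ θ₀ := by
  obtain ⟨C, c, h⟩ := hpencil θ₀
  set l : Θ → ℝ := fun θ => sInf (pencilLevels (T θ) B (n + 1)) with hl
  change T θ₀ u₀ = ((l θ₀ : ℝ) : ℂ) • B u₀ at hTu₀
  change ∀ u, T θ₀ u = ((l θ₀ : ℝ) : ℂ) • B u → ∃ a : ℂ, u = a • u₀ at hsimple
  have hτ : Tendsto (fun θ => θ - θ₀) (𝓝 θ₀) (𝓝 0) := by
    simpa using (tendsto_id (x := 𝓝 θ₀)).sub_const θ₀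
  have hτn : Tendsto (fun θ => ‖θ - θ₀‖) (𝓝 θ₀) (𝓝 0) := by simpa using hτ.norm
  have hL' : ∀ τ, ‖L τ‖ ≤ |M| * ‖τ‖ := fun τ =>
    (hL τ).trans (mul_le_mul_of_nonneg_right (le_abs_self M) (norm_nonneg τ))
  have hTn : Tendsto (fun θ => ‖T θ - T θ₀‖) (𝓝 θ₀) (𝓝 0) := by
    have h1 : Tendsto (fun θ => ‖T θ - T θ₀ - L (θ - θ₀)‖ + |M| * ‖θ - θ₀‖) (𝓝 θ₀) (𝓝 0) := by
      simpa using (hT.trans_tendsto hτ).norm.add (hτn.const_mul |M|)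
    refine squeeze_zero (fun _ => norm_nonneg _) (fun θ => ?_) h1
    calc ‖T θ - T θ₀‖ = ‖(T θ - T θ₀ - L (θ - θ₀)) + L (θ - θ₀)‖ := by rw [sub_add_cancel]
      _ ≤ ‖T θ - T θ₀ - L (θ - θ₀)‖ + ‖L (θ - θ₀)‖ := norm_add_le _ _
      _ ≤ _ := by gcongr; exact hL' _
  have hne' : ∀ θ, (pencilLevels (T θ) B (n + 1)).Nonempty := fun θ => by
    obtain ⟨C', c', h'⟩ := hpencil θ
    obtain ⟨Λ, hΛ⟩ := hne
    exact ⟨_, h.add_mem_pencilLevels h' hΛ⟩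
  have hln : Tendsto (fun θ => |l θ - l θ₀|) (𝓝 θ₀) (𝓝 0) := by
    have h1 : Tendsto (fun θ => ‖T θ - T θ₀‖ / c) (𝓝 θ₀) (𝓝 0) := by
      simpa using hTn.div_const c
    have h2 : Tendsto (fun θ => ‖T θ - T θ₀‖ / c * (l θ₀ + C)) (𝓝 θ₀) (𝓝 0) := by
      simpa using h1.mul_const (l θ₀ + C)
    refine squeeze_zero' (Eventually.of_forall fun _ => abs_nonneg _) ?_ h2
    filter_upwards [h1.eventually_lt_const one_pos] with θ hθ
    obtain ⟨C', c', h'⟩ := hpencil θ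
    exact h.abs_sInf_pencilLevels_sub_le h' hθ hne
  set b : ℝ := (inner ℂ u₀ (B u₀)).re with hb
  have hb0 : 0 < b := h.inner_right_pos hu₀ hTu₀
  have hn0 : 0 < ‖u₀‖ := norm_pos_iff.mpr hu₀
  rw [hasFDerivAt_iff_isLittleO, Asymptotics.isLittleO_iff]
  intro η hη
  -- `ε₁` and `η₂` are chosen so that each of the two remainders in `hkey` is at most `(η b / 4) ‖θ
  -- - θ₀‖`; the cap `1` gives `‖w‖ ≤ ‖u₀‖ + 1`.
  set ε₁ : ℝ := min 1 (η * b / (4 * ‖u₀‖ * (|M| + 1))) with hε₁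
  have hε₁0 : 0 < ε₁ := lt_min one_pos (by positivity)
  obtain ⟨δ, hδ, hnear⟩ := h.approximate_eigenvector_near hu₀ hTu₀ hsimple hε₁0
  set η₂ : ℝ := η * b / (4 * ‖u₀‖ * (‖u₀‖ + 1)) with hη₂
  have hη₂0 : 0 < η₂ := by positivity
  have hsmall : Tendsto (fun θ => ‖T θ - T θ₀‖ + (‖θ - θ₀‖ ^ 2 + |l θ - l θ₀|) * ‖B‖)
      (𝓝 θ₀) (𝓝 0) := by
    simpa using hTn.add (((hτn.pow 2).add hln).mul_const ‖B‖)
  filter_upwards [hsmall.eventually_le_const hδ, Asymptotics.isLittleO_iff.mp hT hη₂0,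
    hτn.eventually_le_const (half_pos hη)] with θ h1 h2 h3
  by_cases hθ : θ = θ₀
  · simp [hθ]
  have hτ0 : 0 < ‖θ - θ₀‖ := norm_pos_iff.mpr (sub_ne_zero.mpr hθ)
  obtain ⟨C', c', h'⟩ := hpencil θ
  -- The tolerance `‖θ - θ₀‖ ^ 2` is of higher order, so replacing `l θ` by `μ` does not affect the
  -- derivative.
  obtain ⟨μ, hμ, u, hu0, hu⟩ := IsCoercivePencil.exists_eigenvector_near_sInf (T θ) B (hne' θ)
    (h'.bddBelow_pencilLevels n) (pow_pos hτ0 2)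
  change |μ - l θ| ≤ ‖θ - θ₀‖ ^ 2 at hμ
  have hres : ‖T θ₀ u - (l θ₀ : ℂ) • B u‖ ≤ δ * ‖u‖ := by
    have e1 : T θ₀ u - (l θ₀ : ℂ) • B u
        = -((T θ - T θ₀) u) + ((μ - l θ₀ : ℝ) : ℂ) • B u := by
      rw [sub_apply, hu, Complex.ofReal_sub, sub_smul]; abel
    have e2 : |μ - l θ₀| ≤ ‖θ - θ₀‖ ^ 2 + |l θ - l θ₀| :=
      (abs_sub_le μ (l θ) (l θ₀)).trans (by gcongr)
    rw [e1]
    refine (norm_add_le _ _).trans ?_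
    rw [norm_neg, norm_smul, Complex.norm_real, Real.norm_eq_abs]
    calc ‖(T θ - T θ₀) u‖ + |μ - l θ₀| * ‖B u‖
        ≤ ‖T θ - T θ₀‖ * ‖u‖ + (‖θ - θ₀‖ ^ 2 + |l θ - l θ₀|) * (‖B‖ * ‖u‖) := by
          gcongr
          · exact ContinuousLinearMap.le_opNorm _ _
          · exact ContinuousLinearMap.le_opNorm _ _
      _ = (‖T θ - T θ₀‖ + (‖θ - θ₀‖ ^ 2 + |l θ - l θ₀|) * ‖B‖) * ‖u‖ := by ring
      _ ≤ δ * ‖u‖ := by gcongr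
  obtain ⟨a, -, hnorm, hclose⟩ := hnear u hu0 hres
  set w := a • u with hw
  have hwT : T θ w = (μ : ℂ) • B w := by rw [hw, map_smul, hu, map_smul, smul_comm]
  have hwn : ‖w‖ ≤ ‖u₀‖ + 1 := by
    calc ‖w‖ = ‖(w - u₀) + u₀‖ := by rw [sub_add_cancel]
      _ ≤ ‖w - u₀‖ + ‖u₀‖ := norm_add_le _ _
      _ ≤ ‖u₀‖ + 1 := by linarith [min_le_left 1 (η * b / (4 * ‖u₀‖ * (|M| + 1)))]
  have hBw : inner ℂ u₀ (B w) = inner ℂ u₀ (B u₀) := by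
    rw [← h.right_pos.inner_left_eq_inner_right, hnorm, h.right_pos.inner_left_eq_inner_right]
  have hTw : inner ℂ u₀ (T θ₀ w) = (l θ₀ : ℂ) * inner ℂ u₀ (B u₀) := by
    rw [← h.left_pos.inner_left_eq_inner_right, hTu₀, inner_smul_left, Complex.conj_ofReal,
      h.right_pos.inner_left_eq_inner_right, hBw]
  -- Pair `T θ w = μ B w` with `u₀`. Symmetry of `T θ₀` and the normalisation `⟪u₀, B w⟫ = ⟪u₀, B
  -- u₀⟫` give `⟪u₀, (T θ - T θ₀) w⟫ = (μ - l θ₀) ⟪u₀, B u₀⟫`, and `hℓ` subtracts the linear term.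
  have hkey : (μ - l θ₀ - ℓ (θ - θ₀)) * b
      = (inner ℂ u₀ ((T θ - T θ₀ - L (θ - θ₀)) w)).re
        + (inner ℂ u₀ (L (θ - θ₀) (w - u₀))).re := by
    have e1 : (T θ - T θ₀ - L (θ - θ₀)) w = T θ w - T θ₀ w - L (θ - θ₀) w := rfl
    rw [e1, map_sub (L (θ - θ₀)), inner_sub_right, inner_sub_right, inner_sub_right, hTw, hwT,
      inner_smul_right, hBw]
    simp only [Complex.sub_re, Complex.re_ofReal_mul, ← hb]
    linarith [hℓ (θ - θ₀)]
  have hR1 : |(inner ℂ u₀ ((T θ - T θ₀ - L (θ - θ₀)) w)).re| ≤ η * b / 4 * ‖θ - θ₀‖ := by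
    calc _ ≤ ‖u₀‖ * ‖(T θ - T θ₀ - L (θ - θ₀)) w‖ :=
          (Complex.abs_re_le_norm _).trans (norm_inner_le_norm _ _)
      _ ≤ ‖u₀‖ * ((η₂ * ‖θ - θ₀‖) * (‖u₀‖ + 1)) := by
          gcongr
          exact (ContinuousLinearMap.le_opNorm _ _).trans (by gcongr)
      _ = η * b / 4 * ‖θ - θ₀‖ := by rw [hη₂]; field_simp
  have hR2 : |(inner ℂ u₀ (L (θ - θ₀) (w - u₀))).re| ≤ η * b / 4 * ‖θ - θ₀‖ := by
    calc _ ≤ ‖u₀‖ * ‖L (θ - θ₀) (w - u₀)‖ :=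
          (Complex.abs_re_le_norm _).trans (norm_inner_le_norm _ _)
      _ ≤ ‖u₀‖ * (((|M| + 1) * ‖θ - θ₀‖) * (η * b / (4 * ‖u₀‖ * (|M| + 1)))) := by
          gcongr
          refine (ContinuousLinearMap.le_opNorm _ _).trans ?_
          gcongr
          · refine (hL' _).trans ?_
            gcongr
            linarith
          · exact hclose.trans (min_le_right _ _)
      _ = η * b / 4 * ‖θ - θ₀‖ := by field_simp
  have hmain : |μ - l θ₀ - ℓ (θ - θ₀)| ≤ η / 2 * ‖θ - θ₀‖ := by
    have e1 : |μ - l θ₀ - ℓ (θ - θ₀)| * b ≤ η / 2 * ‖θ - θ₀‖ * b := by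
      rw [← abs_of_pos hb0, ← abs_mul, abs_of_pos hb0, hkey]
      refine (abs_add_le _ _).trans ?_
      linarith
    exact le_of_mul_le_mul_right e1 hb0
  have hsq : ‖θ - θ₀‖ ^ 2 ≤ η / 2 * ‖θ - θ₀‖ := by
    rw [pow_two]; gcongr
  rw [Real.norm_eq_abs]
  calc |l θ - l θ₀ - ℓ (θ - θ₀)| = |-(μ - l θ) + (μ - l θ₀ - ℓ (θ - θ₀))| := by
        congr 1; ring
    _ ≤ |-(μ - l θ)| + |μ - l θ₀ - ℓ (θ - θ₀)| := abs_add_le _ _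
    _ ≤ η * ‖θ - θ₀‖ := by rw [abs_neg]; linarith

end Pencil

end

/-! ### Fourier series and weak derivatives on the torus -/

noncomputable section

section TorusFourier

open UnitAddTorus

variable {N : ℕ}

/-- Keeping the measure a variable lets `subst` transport `mFourierBasis` from the Haar probability
measure to `volume`, which agrees with it on the unit circle only after evaluating a scalar factor.
-/
theorem exists_hilbertBasis_mFourier_of_eq (μ : Measure UnitAddCircle)
    (hμ : μ = AddCircle.haarAddCircle) :
    ∃ b : HilbertBasis (Fin N → ℤ) ℂ (Lp ℂ 2 (Measure.pi fun _ : Fin N => μ)),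
      ∀ k, b k =ᵐ[Measure.pi fun _ : Fin N => μ] mFourier k := by
  subst hμ
  refine ⟨mFourierBasis, fun k => ?_⟩
  rw [coe_mFourierBasis]
  exact coeFn_mFourierLp 2 k

/-- The Fourier monomials form a Hilbert basis of `L²(𝕋^N)`. -/
theorem exists_hilbertBasis_mFourier (N : ℕ) :
    ∃ b : HilbertBasis (Fin N → ℤ) ℂ (TorusL2 N), ∀ k, b k =ᵐ[volume] mFourier k :=
  exists_hilbertBasis_mFourier_of_eq volume (by
    rw [AddCircle.volume_eq_smul_haarAddCircle]; simp)

theorem isTorusTestFunction_mFourier (k : Fin N → ℤ) : IsTorusTestFunction (mFourier k) := by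
  unfold IsTorusTestFunction
  simp only [mFourier, ContinuousMap.coe_mk, fourier_coe_apply]
  refine contDiff_prod fun i _ => ?_
  refine ContDiff.cexp ?_
  have : ContDiff ℝ (⊤ : ℕ∞) fun x : Fin N → ℝ => ((x i : ℝ) : ℂ) :=
    Complex.ofRealCLM.contDiff.comp (contDiff_apply ℝ ℝ i)
  exact (contDiff_const.mul this).div_const _

theorem torusPartial_mFourier (j : Fin N) (k : Fin N → ℤ) (y : UnitAddTorus (Fin N)) :
    torusPartial j (mFourier k) y = 2 * Real.pi * Complex.I * (k j) * mFourier k y := by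
  unfold torusPartial
  have h1 : (fun t : ℝ => mFourier k (y + Pi.single j (t : UnitAddCircle)))
      = fun t : ℝ => mFourier k y * fourier (k j) (t : UnitAddCircle) := by
    funext t
    simp only [mFourier, ContinuousMap.coe_mk, Pi.add_apply, fourier_apply, smul_add,
      AddCircle.toCircle_add, Circle.coe_mul, Finset.prod_mul_distrib]
    congr 1
    rw [Finset.prod_eq_single j]
    · simp
    · intro i _ hij
      simp [Pi.single_eq_of_ne hij]
    · simp
  rw [h1]
  have h2 := (hasDerivAt_fourier (1 : ℝ) (k j) 0).const_mul (mFourier k y)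
  rw [h2.deriv]
  simp
  ring

/-- Products of quotient maps need not be quotient maps, but products of open quotient maps are. -/
theorem continuous_of_continuous_lift {f : UnitAddTorus (Fin N) → ℂ}
    (hf : Continuous fun x : Fin N → ℝ => f fun i => (x i : UnitAddCircle)) : Continuous f := by
  have hq : IsOpenQuotientMap
      (Pi.map fun _ : Fin N => ((↑) : ℝ → UnitAddCircle)) :=
    IsOpenQuotientMap.piMap fun _ => QuotientAddGroup.isOpenQuotientMap_mk
  exact hq.isQuotientMap.continuous_iff.mpr hf

theorem IsTorusTestFunction.continuous {φ : UnitAddTorus (Fin N) → ℂ}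
    (hφ : IsTorusTestFunction φ) : Continuous φ :=
  continuous_of_continuous_lift (ContDiff.continuous hφ)

theorem IsTorusTestFunction.continuous_torusPartial {φ : UnitAddTorus (Fin N) → ℂ}
    (hφ : IsTorusTestFunction φ) (j : Fin N) : Continuous (torusPartial j φ) := by
  refine continuous_of_continuous_lift ?_
  have h1 : (fun x : Fin N → ℝ => torusPartial j φ fun i => (x i : UnitAddCircle))
      = fun x => fderiv ℝ (fun x : Fin N → ℝ => φ fun i => (x i : UnitAddCircle)) x
        (Pi.single j 1) := by
    funext x
    have hd : DifferentiableAt ℝ (fun x : Fin N → ℝ => φ fun i => (x i : UnitAddCircle)) x :=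
      (ContDiff.differentiable hφ (by simp)) x
    have hline : HasDerivAt (fun t : ℝ => x + t • (Pi.single j 1 : Fin N → ℝ))
        (Pi.single j 1) 0 := by
      simpa using ((hasDerivAt_id (0 : ℝ)).smul_const (Pi.single j 1 : Fin N → ℝ)).const_add x
    have hd' : HasFDerivAt (fun x : Fin N → ℝ => φ fun i => (x i : UnitAddCircle))
        (fderiv ℝ (fun x : Fin N → ℝ => φ fun i => (x i : UnitAddCircle)) x)
        (x + (0 : ℝ) • (Pi.single j 1 : Fin N → ℝ)) := by simpa using hd.hasFDerivAt
    rw [← (hd'.comp_hasDerivAt (0 : ℝ) hline).deriv]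
    unfold torusPartial
    congr 1
    funext t
    simp only [Function.comp]
    congr 1
    funext i
    by_cases hij : i = j
    · subst hij; simp
    · simp [Pi.single_eq_of_ne hij]
  rw [h1]
  exact (ContDiff.continuous_fderiv hφ (by simp)).clm_apply continuous_const

/-- Integration against a continuous function is an inner product in `L²(𝕋^N)`. -/
theorem exists_integral_mul_eq_inner {f : UnitAddTorus (Fin N) → ℂ} (hf : Continuous f) :
    ∃ F : TorusL2 N, ∀ u : TorusL2 N, ∫ y, u y * f y = inner ℂ F u := by
  have hmem : MemLp (fun y => (starRingEnd ℂ) (f y)) 2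
      (volume : Measure (UnitAddTorus (Fin N))) := by
    have hc : Continuous fun y => (starRingEnd ℂ) (f y) := Complex.continuous_conj.comp hf
    exact ContinuousMap.memLp _ ℂ (⟨_, hc⟩ : C(UnitAddTorus (Fin N), ℂ))
  refine ⟨hmem.toLp _, fun u => ?_⟩
  rw [L2.inner_def]
  refine integral_congr_ae ?_
  filter_upwards [hmem.coeFn_toLp] with y hy
  rw [hy, RCLike.inner_apply, Complex.conj_conj]

/-- Test the weak gradient against the conjugate monomial. Uniqueness of the weak gradient and
Rellich's theorem both rest on this identity. -/
theorem HasWeakGradient.inner_mFourier {b : HilbertBasis (Fin N → ℤ) ℂ (TorusL2 N)}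
    (hb : ∀ k, b k =ᵐ[volume] mFourier k) {u : TorusL2 N} {g : Fin N → TorusL2 N}
    (h : HasWeakGradient u g) (j : Fin N) (k : Fin N → ℤ) :
    inner ℂ (b k) (g j) = 2 * Real.pi * Complex.I * (k j) * inner ℂ (b k) u := by
  have hin : ∀ v : TorusL2 N, inner ℂ (b k) v = ∫ y, v y * mFourier (-k) y := fun v => by
    rw [L2.inner_def]
    refine integral_congr_ae ?_
    filter_upwards [hb k] with y hy
    rw [hy, RCLike.inner_apply, mFourier_neg]
  have h1 := h _ (isTorusTestFunction_mFourier (-k)) j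
  simp only [torusPartial_mFourier] at h1
  rw [hin, hin, ← neg_eq_iff_eq_neg.mpr h1, ← integral_const_mul, ← integral_neg]
  refine integral_congr_ae (Filter.Eventually.of_forall fun y => ?_)
  simp only [Pi.neg_apply, Int.cast_neg]
  ring

end TorusFourier

end

/-! ### The Sobolev space `H¹(𝕋^N)` and Rellich's theorem -/

noncomputable section

section TorusSobolev

open Filter Topology

variable {N : ℕ}

/-- The Hilbert space `L²(𝕋^N; ℂ^N)` of square integrable vector fields. -/
abbrev TorusVectorL2 (N : ℕ) : Type :=
  PiLp 2 fun _ : Fin N => TorusL2 N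

/-- Each test function gives a continuous linear condition on `(u, g)`. Hence the graph of the weak
gradient is a closed subspace, and `H¹` is complete. -/
theorem hasWeakGradient_iff_inner : ∃ F : (UnitAddTorus (Fin N) → ℂ) → Fin N → TorusL2 N,
    ∃ G : (UnitAddTorus (Fin N) → ℂ) → TorusL2 N, ∀ u : TorusL2 N, ∀ g : Fin N → TorusL2 N,
      HasWeakGradient u g ↔ ∀ φ, IsTorusTestFunction φ → ∀ j,
        inner ℂ (F φ j) u + inner ℂ (G φ) (g j) = 0 := by
  classical
  have h1 : ∀ φ : UnitAddTorus (Fin N) → ℂ, ∃ Fφ : Fin N → TorusL2 N, ∃ Gφ : TorusL2 N,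
      IsTorusTestFunction φ → (∀ j, ∀ u : TorusL2 N,
        ∫ y, u y * torusPartial j φ y = inner ℂ (Fφ j) u) ∧
        ∀ u : TorusL2 N, ∫ y, u y * φ y = inner ℂ Gφ u := by
    intro φ
    by_cases hφ : IsTorusTestFunction φ
    · choose F hF using fun j => exists_integral_mul_eq_inner (hφ.continuous_torusPartial j)
      obtain ⟨G, hG⟩ := exists_integral_mul_eq_inner hφ.continuous
      exact ⟨F, G, fun _ => ⟨hF, hG⟩⟩
    · exact ⟨0, 0, fun h => absurd h hφ⟩
  choose F G hFG using h1
  refine ⟨F, G, fun u g => forall_congr' fun φ => forall_congr' fun hφ => forall_congr' fun j => ?_⟩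
  rw [(hFG φ hφ).1, (hFG φ hφ).2, eq_neg_iff_add_eq_zero]

/-- The Sobolev space `H¹(𝕋^N)`, realised as the graph of the weak gradient. -/
def torusSobolev (N : ℕ) : Submodule ℂ (WithLp 2 (TorusL2 N × TorusVectorL2 N)) where
  carrier := {p | HasWeakGradient p.fst p.snd}
  zero_mem' := by
    obtain ⟨F, G, h⟩ := hasWeakGradient_iff_inner (N := N)
    simp [h]
  add_mem' := by
    obtain ⟨F, G, h⟩ := hasWeakGradient_iff_inner (N := N)
    intro p q hp hq
    simp only [Set.mem_ofPred_eq, h] at hp hq ⊢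
    intro φ hφ j
    have e : inner ℂ (F φ j) (p + q).fst + inner ℂ (G φ) ((p + q).snd j)
        = (inner ℂ (F φ j) p.fst + inner ℂ (G φ) (p.snd j))
          + (inner ℂ (F φ j) q.fst + inner ℂ (G φ) (q.snd j)) := by
      simp only [WithLp.add_fst, WithLp.add_snd, PiLp.add_apply, inner_add_right]
      ring
    rw [e, hp φ hφ j, hq φ hφ j, add_zero]
  smul_mem' := by
    obtain ⟨F, G, h⟩ := hasWeakGradient_iff_inner (N := N)
    intro a p hp
    simp only [Set.mem_ofPred_eq, h] at hp ⊢
    intro φ hφ j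
    have e : inner ℂ (F φ j) (a • p).fst + inner ℂ (G φ) ((a • p).snd j)
        = a * (inner ℂ (F φ j) p.fst + inner ℂ (G φ) (p.snd j)) := by
      simp only [WithLp.smul_fst, WithLp.smul_snd, PiLp.smul_apply, inner_smul_right]
      ring
    rw [e, hp φ hφ j, mul_zero]

/-- The Hilbert space `H¹(𝕋^N)`. -/
def TorusH1 (N : ℕ) : Type := torusSobolev N

instance : NormedAddCommGroup (TorusH1 N) := inferInstanceAs (NormedAddCommGroup (torusSobolev N))

instance : InnerProductSpace ℂ (TorusH1 N) :=
  inferInstanceAs (InnerProductSpace ℂ (torusSobolev N))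

instance : CompleteSpace (TorusH1 N) := by
  obtain ⟨F, G, h⟩ := hasWeakGradient_iff_inner (N := N)
  have hcl : IsClosed (torusSobolev N : Set (WithLp 2 (TorusL2 N × TorusVectorL2 N))) := by
    have e : (torusSobolev N : Set (WithLp 2 (TorusL2 N × TorusVectorL2 N)))
        = ⋂ φ, ⋂ (_ : IsTorusTestFunction φ), ⋂ j,
          {p | inner ℂ (F φ j) (WithLp.fstL 2 ℂ _ _ p)
            + inner ℂ (G φ) (PiLp.proj (𝕜 := ℂ) 2 (fun _ : Fin N => TorusL2 N) j
              (WithLp.sndL 2 ℂ _ _ p)) = 0} := by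
      ext p
      simp only [Set.mem_iInter, Set.mem_ofPred_eq]
      exact h p.fst p.snd
    rw [e]
    refine isClosed_iInter fun φ => isClosed_iInter fun _ => isClosed_iInter fun j => ?_
    exact isClosed_eq (by fun_prop) continuous_const
  exact hcl.completeSpace_coe

/-- The embedding of `H¹(𝕋^N)` into `L²(𝕋^N)`. -/
def sobolevEmbedding (N : ℕ) : TorusH1 N →L[ℂ] TorusL2 N :=
  (WithLp.fstL 2 ℂ _ _ ∘L (torusSobolev N).subtypeL : torusSobolev N →L[ℂ] TorusL2 N)

/-- The gradient on `H¹(𝕋^N)`. -/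
def sobolevGradient (N : ℕ) : TorusH1 N →L[ℂ] TorusVectorL2 N :=
  (WithLp.sndL 2 ℂ _ _ ∘L (torusSobolev N).subtypeL : torusSobolev N →L[ℂ] TorusVectorL2 N)

theorem hasWeakGradient_sobolevGradient (p : TorusH1 N) :
    HasWeakGradient (sobolevEmbedding N p) (sobolevGradient N p) :=
  p.2

theorem norm_sq_torusH1 (p : TorusH1 N) :
    ‖p‖ ^ 2 = ‖sobolevEmbedding N p‖ ^ 2 + ‖sobolevGradient N p‖ ^ 2 :=
  WithLp.prod_norm_sq_eq_of_L2 p.1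

theorem HasWeakGradient.exists_sobolev {u : TorusL2 N} {g : Fin N → TorusL2 N}
    (h : HasWeakGradient u g) : ∃ p : TorusH1 N, sobolevEmbedding N p = u ∧
      ∀ j, sobolevGradient N p j = g j :=
  ⟨⟨WithLp.toLp 2 (u, WithLp.toLp 2 g), h⟩, rfl, fun _ => rfl⟩

theorem HilbertBasis.hasSum_norm_inner_sq {ι E : Type*} [NormedAddCommGroup E]
    [InnerProductSpace ℂ E] (b : HilbertBasis ι ℂ E) (x : E) :
    HasSum (fun i => ‖inner ℂ (b i) x‖ ^ 2) (‖x‖ ^ 2) := by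
  have h1 := RCLike.hasSum_re ℂ (b.hasSum_inner_mul_inner x x)
  rw [inner_self_eq_norm_sq] at h1
  refine h1.congr_fun fun i => ?_
  rw [← inner_conj_symm, RCLike.mul_conj, RCLike.norm_conj]
  norm_cast

theorem injective_sobolevEmbedding : Function.Injective (sobolevEmbedding N) := by
  obtain ⟨b, hb⟩ := exists_hilbertBasis_mFourier N
  rw [injective_iff_map_eq_zero]
  intro p hp
  have hg : sobolevGradient N p = 0 := by
    ext1 j
    have h1 : ∀ k, ‖inner ℂ (b k) (sobolevGradient N p j)‖ ^ 2 = 0 := fun k => by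
      rw [(hasWeakGradient_sobolevGradient p).inner_mFourier hb j k, hp]
      simp
    have h2 := b.hasSum_norm_inner_sq (sobolevGradient N p j)
    simp only [h1] at h2
    have h3 := h2.unique hasSum_zero
    simpa using h3
  have h := norm_sq_torusH1 p
  rw [hp, hg] at h
  simpa using h

/-- **Rellich's theorem** on the torus. -/
theorem isCompactOperator_sobolevEmbedding (N : ℕ) :
    IsCompactOperator (sobolevEmbedding N) := by
  obtain ⟨b, hb⟩ := exists_hilbertBasis_mFourier N
  set box : ℕ → Finset (Fin N → ℤ) := fun n =>
    Finset.Icc (fun _ => -(n : ℤ)) (fun _ => (n : ℤ)) with hbox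
  -- Fourier truncation to the box `|k_j| ≤ n`, of finite rank. The embedding is the norm limit of
  -- its truncations, with error at most `1 / (n + 1)`.
  set P : ℕ → TorusL2 N →L[ℂ] TorusL2 N := fun n =>
    ∑ k ∈ box n, (ContinuousLinearMap.toSpanSingleton ℂ (b k)) ∘L (innerSL ℂ (b k)) with hP
  have hPapp : ∀ n u, P n u = ∑ k ∈ box n, inner ℂ (b k) u • b k := fun n u => by
    simp [hP]
  have hPc : ∀ n, IsCompactOperator (P n) := fun n => by
    have : P n ∈ compactOperator (RingHom.id ℂ) (TorusL2 N) (TorusL2 N) := by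
      refine Submodule.sum_mem _ fun k _ => ?_
      exact (isCompactOperator_of_locallyCompactSpace_rng
        (ContinuousLinearMap.toSpanSingleton ℂ (b k))).comp_clm (innerSL ℂ (b k))
    exact this
  have hcoef : ∀ n u k, inner ℂ (b k) (u - P n u) = if k ∈ box n then 0 else inner ℂ (b k) u := by
    classical
    intro n u k
    rw [inner_sub_right, hPapp, inner_sum]
    simp only [inner_smul_right, orthonormal_iff_ite.mp b.orthonormal, mul_ite, mul_one, mul_zero,
      Finset.sum_ite_eq]
    split_ifs <;> simp
  have hbound : ∀ n : ℕ, ∀ p : TorusH1 N,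
      ‖sobolevEmbedding N p - P n (sobolevEmbedding N p)‖ ≤ 1 / ((n : ℝ) + 1) * ‖p‖ := by
    intro n p
    set u := sobolevEmbedding N p with hu
    set g := sobolevGradient N p with hg
    have h1 := (b.hasSum_norm_inner_sq (u - P n u)).mul_left (((n : ℝ) + 1) ^ 2)
    have h2 : HasSum (fun k => ∑ j, ‖inner ℂ (b k) (g j)‖ ^ 2) (∑ j, ‖g j‖ ^ 2) :=
      hasSum_sum fun j _ => b.hasSum_norm_inner_sq (g j)
    have h3 : ((n : ℝ) + 1) ^ 2 * ‖u - P n u‖ ^ 2 ≤ ∑ j, ‖g j‖ ^ 2 := by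
      refine hasSum_le (fun k => ?_) h1 h2
      rw [hcoef]
      split_ifs with hk
      · simp only [norm_zero]
        rw [zero_pow two_ne_zero, mul_zero]
        positivity
      -- Outside the box some `|k_j| ≥ n + 1`, so the `k`-th coefficient of `∂_j u`, with its factor
      -- `2π k_j`, dominates `n + 1` times that of `u`.
      · have : ∃ j, (n : ℤ) + 1 ≤ |k j| := by
          by_contra! hcon
          refine hk (Finset.mem_Icc.mpr ⟨fun j => ?_, fun j => ?_⟩)
          · exact (abs_le.mp (Int.lt_add_one_iff.mp (hcon j))).1
          · exact (abs_le.mp (Int.lt_add_one_iff.mp (hcon j))).2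
        obtain ⟨j, hj⟩ := this
        refine le_trans ?_ (Finset.single_le_sum (f := fun j => ‖inner ℂ (b k) (g j)‖ ^ 2)
          (fun _ _ => by positivity) (Finset.mem_univ j))
        simp only
        rw [(hasWeakGradient_sobolevGradient p).inner_mFourier hb j k, ← hu, ← mul_pow]
        refine pow_le_pow_left₀ (by positivity) ?_ 2
        rw [norm_mul]
        refine mul_le_mul_of_nonneg_right ?_ (norm_nonneg _)
        have hkj : (n : ℝ) + 1 ≤ |(k j : ℝ)| := by exact_mod_cast hj
        simp only [norm_mul, Complex.norm_I, Complex.norm_real, Complex.norm_intCast,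
          Real.norm_eq_abs, abs_of_pos Real.pi_pos, Complex.norm_ofNat, mul_one]
        have hpi := Real.pi_gt_three
        nlinarith [abs_nonneg (k j : ℝ)]
    have h4 : ∑ j, ‖g j‖ ^ 2 ≤ ‖p‖ ^ 2 := by
      rw [norm_sq_torusH1, ← hg, PiLp.norm_sq_eq_of_L2]
      have := sq_nonneg ‖sobolevEmbedding N p‖
      linarith
    rw [one_div, ← div_eq_inv_mul, le_div_iff₀ (by positivity)]
    refine le_of_sq_le_sq ?_ (norm_nonneg p)
    rw [mul_pow]
    linarith
  have hlim : Tendsto (fun n => P n ∘L sobolevEmbedding N) atTop (𝓝 (sobolevEmbedding N)) := by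
    refine (tendsto_iff_norm_sub_tendsto_zero (E := TorusH1 N →L[ℂ] TorusL2 N)).mpr ?_
    refine squeeze_zero (fun n => norm_nonneg (P n ∘L sobolevEmbedding N - sobolevEmbedding N))
      (fun n => ?_) tendsto_one_div_add_atTop_nhds_zero_nat
    refine ContinuousLinearMap.opNorm_le_bound _ (by positivity) fun p => ?_
    rw [sub_apply, norm_sub_rev]
    exact hbound n p
  exact isCompactOperator_of_tendsto hlim
    (Eventually.of_forall fun n => (hPc n).comp_clm (sobolevEmbedding N))

end TorusSobolev

end

/-! ### The Bloch cell problem as an operator pencil on `H¹` -/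

noncomputable section

section BlochOperator

open Filter Topology ContinuousLinearMap

variable {N : ℕ}

theorem exists_multiplication_operator {f : UnitAddTorus (Fin N) → ℝ} (hf : MemLp f ⊤ volume) :
    ∃ M : TorusL2 N →L[ℂ] TorusL2 N, ∀ u : TorusL2 N, M u =ᵐ[volume] fun y => (f y : ℂ) * u y := by
  have hfc : MemLp (fun y => (f y : ℂ)) ⊤ volume := hf.ofReal
  refine ⟨(ContinuousLinearMap.mul ℂ ℂ).holderL volume ⊤ 2 2 (hfc.toLp _), fun u => ?_⟩
  rw [holderL_apply_apply]
  filter_upwards [coeFn_holder (r := 2) (ContinuousLinearMap.mul ℂ ℂ) (hfc.toLp _) u,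
    hfc.coeFn_toLp] with y h1 h2
  rw [h1, h2]
  rfl

theorem integral_norm_sq_torusL2 (u : TorusL2 N) :
    Integrable (fun y => ‖u y‖ ^ 2) ∧ ∫ y, ‖u y‖ ^ 2 = ‖u‖ ^ 2 := by
  have hint : Integrable (fun y => ‖u y‖ ^ 2) := (Lp.memLp u).integrable_norm_pow (by simp)
  refine ⟨hint, ?_⟩
  have h1 : ((‖u‖ ^ 2 : ℝ) : ℂ) = ∫ y, ((‖u y‖ ^ 2 : ℝ) : ℂ) := by
    have h2 := L2.inner_def (𝕜 := ℂ) u u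
    rw [inner_self_eq_norm_sq_to_K] at h2
    simp only [inner_self_eq_norm_sq_to_K] at h2
    simpa using h2
  rw [integral_complex_ofReal] at h1
  exact_mod_cast h1.symm

theorem exists_matrix_multiplication_operator {A : UnitAddTorus (Fin N) → Matrix (Fin N) (Fin N) ℝ}
    (hA : ∀ i j, MemLp (fun y => A y i j) ⊤ volume) :
    ∃ 𝒜 : TorusVectorL2 N →L[ℂ] TorusVectorL2 N, ∀ p q : TorusVectorL2 N,
      Integrable (fun y => ∑ i, ∑ j, (A y i j : ℂ) * p j y * (starRingEnd ℂ) (q i y)) ∧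
      inner ℂ q (𝒜 p) = ∫ y, ∑ i, ∑ j, (A y i j : ℂ) * p j y * (starRingEnd ℂ) (q i y) := by
  choose M hM using fun i j => exists_multiplication_operator (hA i j)
  refine ⟨(PiLp.continuousLinearEquiv 2 ℂ fun _ : Fin N => TorusL2 N).symm ∘L
    ContinuousLinearMap.pi fun i => ∑ j, M i j ∘L PiLp.proj 2 (fun _ : Fin N => TorusL2 N) j,
    fun p q => ?_⟩
  have hae : ∀ i j, (fun y => inner ℂ (q i y) (M i j (p j) y)) =ᵐ[volume]
      fun y => (A y i j : ℂ) * p j y * (starRingEnd ℂ) (q i y) := fun i j => by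
    filter_upwards [hM i j (p j)] with y hy
    rw [hy, RCLike.inner_apply]
  have hint : ∀ i j, Integrable fun y => (A y i j : ℂ) * p j y * (starRingEnd ℂ) (q i y) :=
    fun i j => (L2.integrable_inner (𝕜 := ℂ) (q i) (M i j (p j))).congr (hae i j)
  refine ⟨integrable_finsetSum _ fun i _ => integrable_finsetSum _ fun j _ => hint i j, ?_⟩
  rw [integral_finsetSum _ fun i _ => integrable_finsetSum _ fun j _ => hint i j,
    PiLp.inner_apply]
  refine Finset.sum_congr rfl fun i _ => ?_
  rw [integral_finsetSum _ fun j _ => hint i j]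
  change inner ℂ (q i) ((∑ j, M i j ∘L PiLp.proj 2 (fun _ : Fin N => TorusL2 N) j) p) = _
  rw [sum_apply, inner_sum]
  refine Finset.sum_congr rfl fun j _ => ?_
  change inner ℂ (q i) (M i j (p j)) = _
  rw [L2.inner_def]
  exact integral_congr_ae (hae i j)

/-- The mixed real–imaginary terms cancel by symmetry. Coercivity on real vectors thereby passes to
complex fields. -/
theorem sum_symm_mul_conj {A : Matrix (Fin N) (Fin N) ℝ} (hA : A.IsSymm) (z : Fin N → ℂ) :
    ∑ i, ∑ j, (A i j : ℂ) * z j * (starRingEnd ℂ) (z i) =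
      ((∑ i, ∑ j, A i j * (z j).re * (z i).re + ∑ i, ∑ j, A i j * (z j).im * (z i).im : ℝ) : ℂ) := by
  apply Complex.ext
  · simp only [Complex.re_sum, Complex.ofReal_re, ← Finset.sum_add_distrib]
    refine Finset.sum_congr rfl fun i _ => Finset.sum_congr rfl fun j _ => ?_
    simp [Complex.mul_re, Complex.mul_im]
  · simp only [Complex.im_sum, Complex.ofReal_im]
    have h1 : ∑ i, ∑ j, ((A i j : ℂ) * z j * (starRingEnd ℂ) (z i)).im
        = ∑ i, ∑ j, A i j * (z j).im * (z i).re - ∑ i, ∑ j, A i j * (z j).re * (z i).im := by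
      simp only [← Finset.sum_sub_distrib]
      refine Finset.sum_congr rfl fun i _ => Finset.sum_congr rfl fun j _ => ?_
      simp [Complex.mul_re, Complex.mul_im]
      ring
    rw [h1, sub_eq_zero, Finset.sum_comm]
    refine Finset.sum_congr rfl fun i _ => Finset.sum_congr rfl fun j _ => ?_
    rw [hA.apply i j]
    ring

theorem isPositive_of_inner_eq_ofReal {E : Type*} [NormedAddCommGroup E] [InnerProductSpace ℂ E]
    {T : E →L[ℂ] E} (h : ∀ x, ∃ a : ℝ, 0 ≤ a ∧ inner ℂ x (T x) = (a : ℂ)) : T.IsPositive := by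
  rw [isPositive_iff_complex]
  intro x
  obtain ⟨a, ha, hx⟩ := h x
  have h1 : inner ℂ (T x) x = (a : ℂ) := by
    rw [← inner_conj_symm, hx, Complex.conj_ofReal]
  rw [h1]
  exact ⟨by simp, by simpa using ha⟩

/-- A matrix multiplication operator with symmetric coercive coefficients is coercive. -/
theorem matrix_multiplication_coercive {A : UnitAddTorus (Fin N) → Matrix (Fin N) (Fin N) ℝ}
    (hA_symm : ∀ᵐ y, (A y).IsSymm) {α : ℝ}
    (hA_coercive : ∀ᵐ y, ∀ ξ : Fin N → ℝ, α * ∑ i, ξ i ^ 2 ≤ ∑ i, ∑ j, A y i j * ξ j * ξ i)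
    {𝒜 : TorusVectorL2 N →L[ℂ] TorusVectorL2 N}
    (h𝒜 : ∀ p q : TorusVectorL2 N,
      Integrable (fun y => ∑ i, ∑ j, (A y i j : ℂ) * p j y * (starRingEnd ℂ) (q i y)) ∧
      inner ℂ q (𝒜 p) = ∫ y, ∑ i, ∑ j, (A y i j : ℂ) * p j y * (starRingEnd ℂ) (q i y))
    (p : TorusVectorL2 N) :
    ∃ a : ℝ, α * ‖p‖ ^ 2 ≤ a ∧ inner ℂ p (𝒜 p) = (a : ℂ) := by
  set f : UnitAddTorus (Fin N) → ℝ := fun y => ∑ i, ∑ j, A y i j * (p j y).re * (p i y).re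
    + ∑ i, ∑ j, A y i j * (p j y).im * (p i y).im with hf
  obtain ⟨h1, h2⟩ := h𝒜 p p
  have hae : (fun y => ∑ i, ∑ j, (A y i j : ℂ) * p j y * (starRingEnd ℂ) (p i y)) =ᵐ[volume]
      fun y => (f y : ℂ) := by
    filter_upwards [hA_symm] with y hy
    exact sum_symm_mul_conj hy fun i => p i y
  have hfint : Integrable f := by
    have := (h1.congr hae).re
    simpa using this
  refine ⟨∫ y, f y, ?_, ?_⟩
  · have h3 : α * ‖p‖ ^ 2 = ∫ y, α * ∑ i, ‖p i y‖ ^ 2 := by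
      rw [integral_const_mul, integral_finsetSum _ fun i _ => (integral_norm_sq_torusL2 (p i)).1,
        PiLp.norm_sq_eq_of_L2]
      simp only [(integral_norm_sq_torusL2 _).2]
    rw [h3]
    refine integral_mono_ae ((integrable_finsetSum _ fun i _ =>
      (integral_norm_sq_torusL2 (p i)).1).const_mul α) hfint ?_
    filter_upwards [hA_coercive] with y hy
    have h4 := hy fun i => (p i y).re
    have h5 := hy fun i => (p i y).im
    have h6 : ∑ i, ‖p i y‖ ^ 2 = ∑ i, (p i y).re ^ 2 + ∑ i, (p i y).im ^ 2 := by
      rw [← Finset.sum_add_distrib]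
      refine Finset.sum_congr rfl fun i _ => ?_
      rw [Complex.sq_norm, Complex.normSq_apply]; ring
    simp only [h6, hf, mul_add]
    linarith
  · rw [h2, integral_congr_ae hae, integral_complex_ofReal]

theorem multiplication_coercive {ρ : UnitAddTorus (Fin N) → ℝ} {r : ℝ}
    (hρ_lower : ∀ᵐ y, r ≤ ρ y) {M : TorusL2 N →L[ℂ] TorusL2 N}
    (hM : ∀ u : TorusL2 N, M u =ᵐ[volume] fun y => (ρ y : ℂ) * u y) (u : TorusL2 N) :
    Integrable (fun y => ρ y * ‖u y‖ ^ 2) ∧ r * ‖u‖ ^ 2 ≤ ∫ y, ρ y * ‖u y‖ ^ 2 ∧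
      inner ℂ u (M u) = ((∫ y, ρ y * ‖u y‖ ^ 2 : ℝ) : ℂ) := by
  have hae : (fun y => inner ℂ (u y) (M u y)) =ᵐ[volume]
      fun y => ((ρ y * ‖u y‖ ^ 2 : ℝ) : ℂ) := by
    filter_upwards [hM u] with y hy
    rw [hy, RCLike.inner_apply, mul_assoc, RCLike.mul_conj]
    simp
  have hint : Integrable (fun y => ρ y * ‖u y‖ ^ 2) := by
    have := ((L2.integrable_inner (𝕜 := ℂ) u (M u)).congr hae).re
    simpa only [RCLike.re_eq_complex_re, Complex.ofReal_re] using this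
  refine ⟨hint, ?_, ?_⟩
  · rw [← (integral_norm_sq_torusL2 u).2, ← integral_const_mul]
    refine integral_mono_ae ((integral_norm_sq_torusL2 u).1.const_mul r) hint ?_
    filter_upwards [hρ_lower] with y hy
    exact mul_le_mul_of_nonneg_right hy (by positivity)
  · rw [L2.inner_def, integral_congr_ae hae, integral_complex_ofReal]

/-- The map `u ↦ 2iπθ u` from `L²(𝕋^N)` to vector fields. -/
def phaseShift (θ : EuclideanSpace ℝ (Fin N)) : TorusL2 N →L[ℂ] TorusVectorL2 N :=
  (PiLp.continuousLinearEquiv 2 ℂ fun _ : Fin N => TorusL2 N).symm ∘L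
    ContinuousLinearMap.pi fun j =>
      (2 * Complex.I * (Real.pi : ℂ) * (θ j : ℂ)) • ContinuousLinearMap.id ℂ (TorusL2 N)

theorem phaseShift_apply (θ : EuclideanSpace ℝ (Fin N)) (u : TorusL2 N) (j : Fin N) :
    phaseShift θ u j = (2 * Complex.I * (Real.pi : ℂ) * (θ j : ℂ)) • u := rfl

/-- The shifted gradient `∇ + 2iπθ` on `H¹(𝕋^N)`. -/
def blochGradient (θ : EuclideanSpace ℝ (Fin N)) : TorusH1 N →L[ℂ] TorusVectorL2 N :=
  sobolevGradient N + phaseShift θ ∘L sobolevEmbedding N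

theorem blochGradient_ae (θ : EuclideanSpace ℝ (Fin N)) (p : TorusH1 N) (j : Fin N) :
    blochGradient θ p j =ᵐ[volume]
      shiftedGradient θ (sobolevEmbedding N p) (sobolevGradient N p) j := by
  have e : blochGradient θ p j = sobolevGradient N p j
      + (2 * Complex.I * (Real.pi : ℂ) * (θ j : ℂ)) • sobolevEmbedding N p := rfl
  rw [e]
  filter_upwards [Lp.coeFn_add (sobolevGradient N p j)
    ((2 * Complex.I * (Real.pi : ℂ) * (θ j : ℂ)) • sobolevEmbedding N p),
    Lp.coeFn_smul (2 * Complex.I * (Real.pi : ℂ) * (θ j : ℂ)) (sobolevEmbedding N p)] with y h1 h2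
  rw [h1, Pi.add_apply, h2, Pi.smul_apply, smul_eq_mul]
  rfl

/-- The operator `D* S D`, representing the form `⟪D x, S D y⟫`. -/
def formOperator {E F : Type*} [NormedAddCommGroup E] [InnerProductSpace ℂ E] [CompleteSpace E]
    [NormedAddCommGroup F] [InnerProductSpace ℂ F] [CompleteSpace F] (S : F →L[ℂ] F)
    (D : E →L[ℂ] F) : E →L[ℂ] E :=
  (adjoint D) ∘L S ∘L D

theorem inner_formOperator {E F : Type*} [NormedAddCommGroup E] [InnerProductSpace ℂ E]
    [CompleteSpace E] [NormedAddCommGroup F] [InnerProductSpace ℂ F] [CompleteSpace F]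
    (S : F →L[ℂ] F) (D : E →L[ℂ] F) (p q : E) :
    inner ℂ q (formOperator S D p) = inner ℂ (D q) (S (D p)) := by
  rw [formOperator, ContinuousLinearMap.comp_apply, adjoint_inner_right,
    ContinuousLinearMap.comp_apply]

theorem isCompactOperator_formOperator {E F : Type*} [NormedAddCommGroup E]
    [InnerProductSpace ℂ E] [CompleteSpace E] [NormedAddCommGroup F] [InnerProductSpace ℂ F]
    [CompleteSpace F] (S : F →L[ℂ] F) {D : E →L[ℂ] F} (hD : IsCompactOperator D) :
    IsCompactOperator (formOperator S D) :=
  (hD.clm_comp S).clm_comp (adjoint D)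

/-- The operator on `H¹(𝕋^N)` representing the form of the Bloch cell problem. -/
def blochOperator (𝒜 : TorusVectorL2 N →L[ℂ] TorusVectorL2 N) (θ : EuclideanSpace ℝ (Fin N)) :
    TorusH1 N →L[ℂ] TorusH1 N :=
  formOperator 𝒜 (blochGradient θ)

/-- The operator on `H¹(𝕋^N)` representing the weighted `L²` inner product. -/
def densityOperator (M : TorusL2 N →L[ℂ] TorusL2 N) : TorusH1 N →L[ℂ] TorusH1 N :=
  formOperator M (sobolevEmbedding N)

theorem inner_blochOperator (𝒜 : TorusVectorL2 N →L[ℂ] TorusVectorL2 N)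
    (θ : EuclideanSpace ℝ (Fin N)) (p q : TorusH1 N) :
    inner ℂ q (blochOperator 𝒜 θ p) = inner ℂ (blochGradient θ q) (𝒜 (blochGradient θ p)) :=
  inner_formOperator _ _ _ _

theorem inner_densityOperator (M : TorusL2 N →L[ℂ] TorusL2 N) (p q : TorusH1 N) :
    inner ℂ q (densityOperator M p)
      = inner ℂ (sobolevEmbedding N q) (M (sobolevEmbedding N p)) :=
  inner_formOperator _ _ _ _

variable {A : UnitAddTorus (Fin N) → Matrix (Fin N) (Fin N) ℝ} {ρ : UnitAddTorus (Fin N) → ℝ}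
  {𝒜 : TorusVectorL2 N →L[ℂ] TorusVectorL2 N} {M : TorusL2 N →L[ℂ] TorusL2 N}

theorem blochForm_eq_inner
    (h𝒜 : ∀ p q : TorusVectorL2 N,
      Integrable (fun y => ∑ i, ∑ j, (A y i j : ℂ) * p j y * (starRingEnd ℂ) (q i y)) ∧
      inner ℂ q (𝒜 p) = ∫ y, ∑ i, ∑ j, (A y i j : ℂ) * p j y * (starRingEnd ℂ) (q i y))
    (θ : EuclideanSpace ℝ (Fin N)) (p q : TorusH1 N) :
    blochForm A θ (sobolevEmbedding N p) (sobolevGradient N p) (sobolevEmbedding N q)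
      (sobolevGradient N q) = inner ℂ q (blochOperator 𝒜 θ p) := by
  rw [inner_blochOperator, (h𝒜 _ _).2, blochForm]
  refine integral_congr_ae ?_
  filter_upwards [eventually_all.mpr (blochGradient_ae θ p),
    eventually_all.mpr (blochGradient_ae θ q)] with y h1 h2
  simp only [h1, h2]

theorem integral_density_eq_inner
    (hM : ∀ u : TorusL2 N, M u =ᵐ[volume] fun y => (ρ y : ℂ) * u y) (p q : TorusH1 N) :
    ∫ y, (ρ y : ℂ) * sobolevEmbedding N p y * (starRingEnd ℂ) (sobolevEmbedding N q y)
      = inner ℂ q (densityOperator M p) := by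
  rw [inner_densityOperator, L2.inner_def]
  refine integral_congr_ae ?_
  filter_upwards [hM (sobolevEmbedding N p)] with y hy
  rw [hy, RCLike.inner_apply]

theorem isBlochEigenfunction_iff
    (h𝒜 : ∀ p q : TorusVectorL2 N,
      Integrable (fun y => ∑ i, ∑ j, (A y i j : ℂ) * p j y * (starRingEnd ℂ) (q i y)) ∧
      inner ℂ q (𝒜 p) = ∫ y, ∑ i, ∑ j, (A y i j : ℂ) * p j y * (starRingEnd ℂ) (q i y))
    (hM : ∀ u : TorusL2 N, M u =ᵐ[volume] fun y => (ρ y : ℂ) * u y)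
    (θ : EuclideanSpace ℝ (Fin N)) (μ : ℝ) (ψ : TorusL2 N) :
    IsBlochEigenfunction A ρ θ μ ψ ↔ ∃ p : TorusH1 N, p ≠ 0 ∧ sobolevEmbedding N p = ψ ∧
      blochOperator 𝒜 θ p = (μ : ℂ) • densityOperator M p := by
  constructor
  · rintro ⟨hψ, g, hg, hw⟩
    obtain ⟨p, rfl, hp⟩ := hg.exists_sobolev
    obtain rfl : (sobolevGradient N p : Fin N → TorusL2 N) = g := funext hp
    refine ⟨p, fun h0 => hψ (by rw [h0, map_zero]), rfl, ext_inner_left ℂ fun q => ?_⟩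
    rw [inner_smul_right, ← blochForm_eq_inner h𝒜, ← integral_density_eq_inner hM]
    exact hw _ _ (hasWeakGradient_sobolevGradient q)
  · rintro ⟨p, hp0, rfl, hp⟩
    refine ⟨fun h0 => hp0 (injective_sobolevEmbedding (by rw [h0, map_zero])), _,
      hasWeakGradient_sobolevGradient p, fun v h hv => ?_⟩
    obtain ⟨q, rfl, hq⟩ := hv.exists_sobolev
    obtain rfl : (sobolevGradient N q : Fin N → TorusL2 N) = h := funext hq
    rw [blochForm_eq_inner h𝒜, integral_density_eq_inner hM, hp, inner_smul_right]

/-- Eigenfunctions in `L²` and pencil eigenvectors in `H¹` correspond under the injective linear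
embedding, which preserves and reflects linear independence. -/
theorem blochEigenvalue_eq_sInf
    (h𝒜 : ∀ p q : TorusVectorL2 N,
      Integrable (fun y => ∑ i, ∑ j, (A y i j : ℂ) * p j y * (starRingEnd ℂ) (q i y)) ∧
      inner ℂ q (𝒜 p) = ∫ y, ∑ i, ∑ j, (A y i j : ℂ) * p j y * (starRingEnd ℂ) (q i y))
    (hM : ∀ u : TorusL2 N, M u =ᵐ[volume] fun y => (ρ y : ℂ) * u y) (n : ℕ)
    (θ : EuclideanSpace ℝ (Fin N)) :
    blochEigenvalue A ρ n θ
      = sInf (pencilLevels (blochOperator 𝒜 θ) (densityOperator M) (n + 1)) := by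
  unfold blochEigenvalue pencilLevels
  congr 1
  ext Λ
  simp only [isBlochEigenfunction_iff h𝒜 hM]
  constructor
  · rintro ⟨ψ, hψ, hev⟩
    choose μ hμ p _ hpψ hp using hev
    obtain rfl : sobolevEmbedding N ∘ p = ψ := funext hpψ
    exact ⟨p, LinearIndependent.of_comp (sobolevEmbedding N : TorusH1 N →ₗ[ℂ] TorusL2 N) hψ,
      fun k => ⟨μ k, hμ k, hp k⟩⟩
  · rintro ⟨p, hp, hev⟩
    refine ⟨sobolevEmbedding N ∘ p,
      hp.map' (sobolevEmbedding N : TorusH1 N →ₗ[ℂ] TorusL2 N)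
        (LinearMap.ker_eq_bot.mpr injective_sobolevEmbedding), fun k => ?_⟩
    obtain ⟨μ, hμ, hk⟩ := hev k
    exact ⟨μ, hμ, p k, hp.ne_zero k, rfl, hk⟩

theorem isCoercivePencil_blochOperator {α r : ℝ} (hα : 0 < α) (hr : 0 < r)
    (h𝒜 : ∀ p, ∃ a : ℝ, α * ‖p‖ ^ 2 ≤ a ∧ inner ℂ p (𝒜 p) = (a : ℂ))
    (hM : ∀ u, ∃ a : ℝ, r * ‖u‖ ^ 2 ≤ a ∧ inner ℂ u (M u) = (a : ℂ))
    (θ : EuclideanSpace ℝ (Fin N)) :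
    ∃ C c, IsCoercivePencil (blochOperator 𝒜 θ) (densityOperator M) C c := by
  set s := ‖phaseShift θ‖
  -- From `∇p = D p - 2iπθ p`, `‖∇p‖² ≤ 2 ‖D p‖² + 2 s² ‖p‖²_{L²}`. Times `α / 2`, the first term is
  -- absorbed by the form of `T`; the remaining `(2 s² + 1) (α / 2) ‖p‖²_{L²}` is paid for by `C B`,
  -- as `ρ ≥ r`.
  refine ⟨(2 * s ^ 2 + 1) * α / (2 * r), α / 2, ?_, ?_, ?_, by positivity, by positivity, ?_⟩
  · refine isPositive_of_inner_eq_ofReal fun p => ?_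
    obtain ⟨a, ha, h⟩ := h𝒜 (blochGradient θ p)
    exact ⟨a, le_trans (by positivity) ha, by rw [inner_blochOperator, h]⟩
  · refine isPositive_of_inner_eq_ofReal fun p => ?_
    obtain ⟨a, ha, h⟩ := hM (sobolevEmbedding N p)
    exact ⟨a, le_trans (by positivity) ha, by rw [inner_densityOperator, h]⟩
  · exact isCompactOperator_formOperator M (isCompactOperator_sobolevEmbedding N)
  · intro p
    obtain ⟨a, ha, h1⟩ := h𝒜 (blochGradient θ p)
    obtain ⟨b, hb, h2⟩ := hM (sobolevEmbedding N p)
    rw [inner_blochOperator, inner_densityOperator, h1, h2, Complex.ofReal_re, Complex.ofReal_re,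
      norm_sq_torusH1]
    set x := ‖sobolevEmbedding N p‖
    set d := ‖blochGradient θ p‖
    have hg : ‖sobolevGradient N p‖ ≤ d + s * x := by
      have e : sobolevGradient N p
          = blochGradient θ p - phaseShift θ (sobolevEmbedding N p) := by
        simp [blochGradient]
      rw [e]
      exact (norm_sub_le _ _).trans (by gcongr; exact le_opNorm _ _)
    have hg2 : ‖sobolevGradient N p‖ ^ 2 ≤ 2 * d ^ 2 + 2 * s ^ 2 * x ^ 2 := by
      have := pow_le_pow_left₀ (norm_nonneg _) hg 2
      nlinarith [sq_nonneg (d - s * x)]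
    have hb' : (2 * s ^ 2 + 1) * α / (2 * r) * b ≥ (2 * s ^ 2 + 1) * α / 2 * x ^ 2 := by
      have h3 := mul_le_mul_of_nonneg_left hb
        (show 0 ≤ (2 * s ^ 2 + 1) * α / (2 * r) by positivity)
      have h4 : (2 * s ^ 2 + 1) * α / (2 * r) * (r * x ^ 2)
          = (2 * s ^ 2 + 1) * α / 2 * x ^ 2 := by field_simp
      linarith
    nlinarith [mul_le_mul_of_nonneg_left hg2 hα.le]

end BlochOperator

end

/-! ### The speed of propagation bounds the coefficients -/

noncomputable section

section LocalSpeed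

theorem le_of_det_sub_eq_zero {n : Type*} [Fintype n] [DecidableEq n] {B : Matrix n n ℝ} {K t : ℝ}
    (hB : ∀ ξ : n → ℝ, ∑ i, ∑ j, B i j * ξ j * ξ i ≤ K * ∑ i, ξ i ^ 2)
    (ht : (B - t • (1 : Matrix n n ℝ)).det = 0) : t ≤ K := by
  obtain ⟨v, hv0, hv⟩ := Matrix.exists_mulVec_eq_zero_iff.mpr ht
  have hBv : ∀ i, ∑ j, B i j * v j = t * v i := fun i => by
    have := congrFun hv i
    rw [Matrix.sub_mulVec, Matrix.smul_mulVec, Matrix.one_mulVec] at this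
    simpa [Matrix.mulVec, dotProduct, sub_eq_zero] using this
  have h1 : ∑ i, ∑ j, B i j * v j * v i = t * ∑ i, v i ^ 2 := by
    simp only [← Finset.sum_mul, hBv, Finset.mul_sum]
    exact Finset.sum_congr rfl fun i _ => by ring
  have h2 : 0 < ∑ i, v i ^ 2 := by
    obtain ⟨i, hi⟩ := Function.ne_iff.mp hv0
    exact Finset.sum_pos' (fun _ _ => sq_nonneg _) ⟨i, Finset.mem_univ i, by
      have : v i ≠ 0 := hi
      positivity⟩
  have h3 := hB v
  rw [h1] at h3
  exact le_of_mul_le_mul_right h3 h2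

/-- An eigenvalue `e` of the symmetric matrix `t I - B` yields the root `t - e` of the
characteristic equation of `B`, so `e ≥ 0` and `t I - B` is positive semidefinite. -/
theorem quadratic_form_le_of_forall_det {n : Type*} [Fintype n] [DecidableEq n]
    {B : Matrix n n ℝ} (hB : B.IsSymm) {t : ℝ}
    (ht : ∀ s, (B - s • (1 : Matrix n n ℝ)).det = 0 → s ≤ t) (ξ : n → ℝ) :
    ∑ i, ∑ j, B i j * ξ j * ξ i ≤ t * ∑ i, ξ i ^ 2 := by
  have hH : (t • (1 : Matrix n n ℝ) - B).IsHermitian := by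
    unfold Matrix.IsHermitian
    rw [Matrix.conjTranspose_sub, Matrix.conjTranspose_smul, Matrix.conjTranspose_one,
      Matrix.conjTranspose_eq_transpose_of_trivial, hB.eq]
    simp
  have hpos : (t • (1 : Matrix n n ℝ) - B).PosSemidef := by
    rw [hH.posSemidef_iff_eigenvalues_nonneg]
    intro i
    have h1 := hH.eigenvalues_mem_spectrum_real i
    rw [spectrum.mem_iff, Matrix.isUnit_iff_isUnit_det, isUnit_iff_ne_zero, not_not,
      Algebra.algebraMap_eq_smul_one] at h1
    have h2 := ht (t - hH.eigenvalues i) (by rw [← h1]; congr 1; rw [sub_smul]; abel)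
    simpa using h2
  have h3 := hpos.dotProduct_mulVec_nonneg ξ
  rw [Matrix.sub_mulVec, Matrix.smul_mulVec, Matrix.one_mulVec, dotProduct_sub] at h3
  simp only [star_trivial, dotProduct, Matrix.mulVec, Pi.smul_apply, smul_eq_mul,
    Finset.mul_sum] at h3
  have h4 : ∑ i, ∑ j, B i j * ξ j * ξ i = ∑ i, ∑ j, ξ i * (B i j * ξ j) :=
    Finset.sum_congr rfl fun i _ => Finset.sum_congr rfl fun j _ => by ring
  have h5 : t * ∑ i, ξ i ^ 2 = ∑ i, ξ i * (t * ξ i) := by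
    rw [Finset.mul_sum]
    exact Finset.sum_congr rfl fun i _ => by ring
  linarith

variable {N : ℕ} {A : UnitAddTorus (Fin N) → Matrix (Fin N) (Fin N) ℝ}
  {ρ : UnitAddTorus (Fin N) → ℝ} {y : UnitAddTorus (Fin N)} {K r : ℝ}

theorem sqrt_le_of_mem_localSpeed_set (hr : 0 < r) (hρ : r ≤ ρ y) (hK : 0 ≤ K)
    (hA : ∀ ξ : Fin N → ℝ, ∑ i, ∑ j, A y i j * ξ j * ξ i ≤ K * ∑ i, ξ i ^ 2) {x : ℝ}
    (hx : x ∈ Real.sqrt '' {μ : ℝ | (A y - (μ * ρ y) • (1 : Matrix (Fin N) (Fin N) ℝ)).det = 0}) :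
    x ≤ Real.sqrt (K / r) := by
  obtain ⟨μ, hμ, rfl⟩ := hx
  have h1 : μ * ρ y ≤ K := le_of_det_sub_eq_zero hA hμ
  refine Real.sqrt_le_sqrt ?_
  rw [le_div_iff₀ hr]
  rcases le_total 0 μ with h0 | h0
  · exact (mul_le_mul_of_nonneg_left hρ h0).trans h1
  · exact (mul_nonpos_of_nonpos_of_nonneg h0 hr.le).trans hK

theorem localSpeed_nonneg (A : UnitAddTorus (Fin N) → Matrix (Fin N) (Fin N) ℝ)
    (ρ : UnitAddTorus (Fin N) → ℝ) (y : UnitAddTorus (Fin N)) : 0 ≤ localSpeed A ρ y :=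
  Real.sSup_nonneg (by rintro _ ⟨μ, -, rfl⟩; exact Real.sqrt_nonneg μ)

theorem localSpeed_le (hr : 0 < r) (hρ : r ≤ ρ y) (hK : 0 ≤ K)
    (hA : ∀ ξ : Fin N → ℝ, ∑ i, ∑ j, A y i j * ξ j * ξ i ≤ K * ∑ i, ξ i ^ 2) :
    localSpeed A ρ y ≤ Real.sqrt (K / r) :=
  Real.sSup_le (fun _ hx => sqrt_le_of_mem_localSpeed_set hr hρ hK hA hx) (Real.sqrt_nonneg _)

theorem quadratic_form_le_localSpeed (hA_symm : (A y).IsSymm) (hr : 0 < r) (hρ : r ≤ ρ y)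
    (hK : 0 ≤ K) (hA : ∀ ξ : Fin N → ℝ, ∑ i, ∑ j, A y i j * ξ j * ξ i ≤ K * ∑ i, ξ i ^ 2)
    (ξ : Fin N → ℝ) :
    ∑ i, ∑ j, A y i j * ξ j * ξ i ≤ localSpeed A ρ y ^ 2 * ρ y * ∑ i, ξ i ^ 2 := by
  have hρ0 : 0 < ρ y := hr.trans_le hρ
  refine quadratic_form_le_of_forall_det hA_symm (fun s hs => ?_) ξ
  have h1 : Real.sqrt (s / ρ y) ≤ localSpeed A ρ y := by
    refine le_csSup ⟨_, fun x hx => sqrt_le_of_mem_localSpeed_set hr hρ hK hA hx⟩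
      ⟨s / ρ y, ?_, rfl⟩
    change (A y - (s / ρ y * ρ y) • (1 : Matrix (Fin N) (Fin N) ℝ)).det = 0
    rwa [div_mul_cancel₀ _ hρ0.ne']
  rw [← div_le_iff₀ hρ0]
  exact (Real.sqrt_le_left (localSpeed_nonneg A ρ y)).mp h1

/-- A crude bound whose only role is to make the suprema defining `localSpeed` and `maxSpeed`
bounded, hence genuine suprema in `ℝ`. -/
theorem exists_ae_quadratic_form_le (hA : ∀ i j, MemLp (fun y => A y i j) ⊤ volume) :
    ∃ K, 0 ≤ K ∧ ∀ᵐ y, ∀ ξ : Fin N → ℝ,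
      ∑ i, ∑ j, A y i j * ξ j * ξ i ≤ K * ∑ i, ξ i ^ 2 := by
  set C : Fin N → Fin N → ℝ := fun i j => lpNorm (fun y => A y i j) ⊤ volume with hC
  have hC0 : ∀ i j, 0 ≤ C i j := fun i j => lpNorm_nonneg
  refine ⟨∑ i, ∑ j, C i j, Finset.sum_nonneg fun i _ => Finset.sum_nonneg fun j _ => hC0 i j, ?_⟩
  have hae : ∀ᵐ y, ∀ i j, |A y i j| ≤ C i j :=
    Filter.eventually_all.mpr fun i => Filter.eventually_all.mpr fun j =>
      ae_le_lpNorm_exponent_top (hA i j)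
  filter_upwards [hae] with y hy ξ
  simp only [Finset.sum_mul]
  refine Finset.sum_le_sum fun i _ => Finset.sum_le_sum fun j _ => ?_
  have h1 : ∀ i, ξ i ^ 2 ≤ ∑ k, ξ k ^ 2 := fun i =>
    Finset.single_le_sum (f := fun k => ξ k ^ 2) (fun _ _ => sq_nonneg _) (Finset.mem_univ i)
  have h2 : |ξ j * ξ i| ≤ ∑ k, ξ k ^ 2 := by
    rw [abs_le]
    constructor <;> nlinarith [h1 i, h1 j, sq_nonneg (ξ i + ξ j), sq_nonneg (ξ i - ξ j)]
  calc A y i j * ξ j * ξ i ≤ |A y i j * ξ j * ξ i| := le_abs_self _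
    _ = |A y i j| * |ξ j * ξ i| := by rw [mul_assoc, abs_mul]
    _ ≤ C i j * ∑ k, ξ k ^ 2 := by
      gcongr
      · exact hC0 i j
      · exact hy i j

/-- The quadratic form of the coefficients is controlled by the maximal speed of propagation. -/
theorem ae_quadratic_form_le_maxSpeed (hA : ∀ i j, MemLp (fun y => A y i j) ⊤ volume)
    (hA_symm : ∀ᵐ y, (A y).IsSymm) (hr : 0 < r) (hρ : ∀ᵐ y, r ≤ ρ y) :
    0 ≤ maxSpeed A ρ ∧ ∀ᵐ y, ∀ ξ : Fin N → ℝ,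
      ∑ i, ∑ j, A y i j * ξ j * ξ i ≤ maxSpeed A ρ ^ 2 * ρ y * ∑ i, ξ i ^ 2 := by
  obtain ⟨K, hK, hAK⟩ := exists_ae_quadratic_form_le hA
  have hle : ∀ᵐ y, localSpeed A ρ y ≤ maxSpeed A ρ := by
    refine ae_le_essSup ⟨Real.sqrt (K / r), ?_⟩
    rw [Filter.eventually_map]
    filter_upwards [hAK, hρ] with y h1 h2
    exact localSpeed_le hr h2 hK h1
  refine ⟨?_, ?_⟩
  · obtain ⟨y, hy⟩ := hle.exists
    exact (localSpeed_nonneg A ρ y).trans hy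
  · filter_upwards [hle, hAK, hρ, hA_symm] with y h1 h2 h3 h4 ξ
    refine (quadratic_form_le_localSpeed h4 hr h3 hK h2 ξ).trans ?_
    have := localSpeed_nonneg A ρ y
    have : 0 ≤ ρ y := hr.le.trans h3
    gcongr

end LocalSpeed

end

/-! ### First-order expansion in `θ` and Cauchy–Schwarz for the form -/

noncomputable section

section GroupVelocity

open Filter Topology ContinuousLinearMap

/-- With `R = S^{1/2}` the form is `⟪R x, R y⟫`, so this is ordinary Cauchy–Schwarz. -/
theorem sq_re_inner_le_of_isPositive {E : Type*} [NormedAddCommGroup E] [InnerProductSpace ℂ E]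
    [CompleteSpace E] {S : E →L[ℂ] E} (hS : S.IsPositive) (x y : E) :
    (inner ℂ x (S y)).re ^ 2 ≤ (inner ℂ x (S x)).re * (inner ℂ y (S y)).re := by
  set R : E →L[ℂ] E := CFC.sqrt S
  have hRR : R * R = S := CFC.sqrt_mul_sqrt_self S ((nonneg_iff_isPositive S).mpr hS)
  have hR : R.IsPositive := (nonneg_iff_isPositive R).mp (CFC.sqrt_nonneg S)
  have h1 : ∀ x y, inner ℂ x (S y) = inner ℂ (R x) (R y) := fun x y => by
    rw [← hRR, mul_apply_eq_comp, hR.inner_left_eq_inner_right]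
  have h2 : ∀ x, (inner ℂ x (S x)).re = ‖R x‖ ^ 2 := fun x => by
    rw [h1]; exact inner_self_eq_norm_sq (𝕜 := ℂ) (R x)
  rw [h2, h2, h1, ← mul_pow, sq_le_sq, abs_of_nonneg (by positivity : 0 ≤ ‖R x‖ * ‖R y‖)]
  exact (Complex.abs_re_le_norm _).trans (norm_inner_le_norm _ _)

section FormOperator

variable {E F : Type*} [NormedAddCommGroup E] [InnerProductSpace ℂ E] [CompleteSpace E]
  [NormedAddCommGroup F] [InnerProductSpace ℂ F] [CompleteSpace F]

/-- The cross term `D* S G + G* S D` in the expansion of `(D + G)* S (D + G)`. -/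
def formCrossOperator (S : F →L[ℂ] F) (D G : E →L[ℂ] F) : E →L[ℂ] E :=
  adjoint D ∘L S ∘L G + adjoint G ∘L S ∘L D

/-- Because `D` is affine in `θ`, the Bloch operator is a quadratic polynomial in `θ`; the Taylor
remainder is exactly the quadratic term. -/
theorem formOperator_add (S : F →L[ℂ] F) (D G : E →L[ℂ] F) :
    formOperator S (D + G) - formOperator S D - formCrossOperator S D G = formOperator S G := by
  unfold formOperator formCrossOperator
  simp only [map_add, comp_add, add_comp]
  abel

theorem norm_formOperator_le (S : F →L[ℂ] F) (D : E →L[ℂ] F) :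
    ‖formOperator S D‖ ≤ ‖S‖ * ‖D‖ ^ 2 := by
  calc ‖formOperator S D‖ ≤ ‖adjoint D‖ * (‖S‖ * ‖D‖) :=
        (opNorm_comp_le _ _).trans (by gcongr; exact opNorm_comp_le _ _)
    _ = ‖S‖ * ‖D‖ ^ 2 := by rw [LinearIsometryEquiv.norm_map]; ring

theorem norm_formCrossOperator_le (S : F →L[ℂ] F) (D G : E →L[ℂ] F) :
    ‖formCrossOperator S D G‖ ≤ 2 * ‖D‖ * ‖S‖ * ‖G‖ := by
  have h1 : ∀ X Y : E →L[ℂ] F, ‖adjoint X ∘L S ∘L Y‖ ≤ ‖X‖ * (‖S‖ * ‖Y‖) := fun X Y => by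
    rw [← LinearIsometryEquiv.norm_map adjoint X]
    exact (opNorm_comp_le _ _).trans (by gcongr; exact opNorm_comp_le _ _)
  refine (norm_add_le _ _).trans ?_
  linarith [h1 D G, h1 G D]

theorem re_inner_formCrossOperator {S : F →L[ℂ] F} (hS : S.IsPositive) (D G : E →L[ℂ] F) (u : E) :
    (inner ℂ u (formCrossOperator S D G u)).re = 2 * (inner ℂ (G u) (S (D u))).re := by
  have h1 : inner ℂ (D u) (S (G u)) = (starRingEnd ℂ) (inner ℂ (G u) (S (D u))) := by
    rw [inner_conj_symm, hS.inner_left_eq_inner_right]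
  rw [formCrossOperator, add_apply, inner_add_right, ContinuousLinearMap.comp_apply,
    ContinuousLinearMap.comp_apply, ContinuousLinearMap.comp_apply,
    ContinuousLinearMap.comp_apply, adjoint_inner_right, adjoint_inner_right, h1, Complex.add_re,
    Complex.conj_re]
  ring

end FormOperator

variable {N : ℕ}

theorem phaseShift_add (θ τ : EuclideanSpace ℝ (Fin N)) :
    phaseShift (θ + τ) = phaseShift θ + phaseShift τ := by
  ext1 u
  ext1 j
  change phaseShift (θ + τ) u j = phaseShift θ u j + phaseShift τ u j
  simp only [phaseShift_apply, PiLp.add_apply, Complex.ofReal_add, mul_add, add_smul]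

theorem phaseShift_smul (a : ℝ) (τ : EuclideanSpace ℝ (Fin N)) :
    phaseShift (a • τ) = (a : ℂ) • phaseShift τ := by
  ext1 u
  ext1 j
  change phaseShift (a • τ) u j = (a : ℂ) • phaseShift τ u j
  simp only [phaseShift_apply, PiLp.smul_apply, smul_smul, smul_eq_mul, Complex.ofReal_mul]
  congr 1
  ring

theorem norm_phaseShift_le (τ : EuclideanSpace ℝ (Fin N)) :
    ‖phaseShift τ‖ ≤ 2 * Real.pi * ‖τ‖ := by
  have hpi := Real.pi_pos
  refine opNorm_le_bound _ (by positivity) fun u => ?_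
  refine le_of_sq_le_sq ?_ (by positivity)
  rw [PiLp.norm_sq_eq_of_L2, mul_pow, mul_pow, EuclideanSpace.norm_sq_eq, Finset.mul_sum,
    Finset.sum_mul]
  refine Finset.sum_le_sum fun j _ => ?_
  rw [phaseShift_apply, norm_smul]
  simp only [norm_mul, Complex.norm_I, Complex.norm_real, Real.norm_eq_abs, abs_of_pos hpi,
    Complex.norm_ofNat, mul_one, mul_pow]
  exact le_rfl

theorem blochGradient_add (θ τ : EuclideanSpace ℝ (Fin N)) :
    blochGradient (θ + τ) = blochGradient θ + phaseShift τ ∘L sobolevEmbedding N := by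
  unfold blochGradient
  rw [phaseShift_add, add_comp, add_assoc]

theorem isLittleO_blochOperator (𝒜 : TorusVectorL2 N →L[ℂ] TorusVectorL2 N)
    (θ₀ : EuclideanSpace ℝ (Fin N)) :
    (fun θ => blochOperator 𝒜 θ - blochOperator 𝒜 θ₀ - formCrossOperator 𝒜 (blochGradient θ₀)
      (phaseShift (θ - θ₀) ∘L sobolevEmbedding N)) =o[𝓝 θ₀] fun θ => θ - θ₀ := by
  set k := ‖𝒜‖ * (2 * Real.pi * ‖sobolevEmbedding N‖) ^ 2
  have h1 : ∀ θ, ‖blochOperator 𝒜 θ - blochOperator 𝒜 θ₀ - formCrossOperator 𝒜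
      (blochGradient θ₀) (phaseShift (θ - θ₀) ∘L sobolevEmbedding N)‖ ≤ k * ‖θ - θ₀‖ ^ 2 := by
    intro θ
    have e : blochGradient θ
        = blochGradient θ₀ + phaseShift (θ - θ₀) ∘L sobolevEmbedding N := by
      rw [← blochGradient_add, add_sub_cancel]
    rw [blochOperator, blochOperator, e, formOperator_add]
    refine (norm_formOperator_le _ _).trans ?_
    calc ‖𝒜‖ * ‖phaseShift (θ - θ₀) ∘L sobolevEmbedding N‖ ^ 2
        ≤ ‖𝒜‖ * ((2 * Real.pi * ‖θ - θ₀‖) * ‖sobolevEmbedding N‖) ^ 2 := by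
          gcongr
          exact (opNorm_comp_le _ _).trans (by gcongr; exact norm_phaseShift_le _)
      _ = k * ‖θ - θ₀‖ ^ 2 := by ring
  have h2 : (fun θ => ‖θ - θ₀‖ ^ 2) =o[𝓝 θ₀] fun θ => θ - θ₀ :=
    Asymptotics.isLittleO_norm_pow_id one_lt_two |>.comp_tendsto (by
      simpa using (tendsto_id (x := 𝓝 θ₀)).sub_const θ₀)
  refine Asymptotics.IsBigO.trans_isLittleO ?_ h2
  refine Asymptotics.IsBigO.of_bound k (Eventually.of_forall fun θ => ?_)
  rw [Real.norm_of_nonneg (by positivity)]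
  exact h1 θ

/-- The integrand is `4π² (A τ·τ) |u|²`, and the pointwise bound on `A` applies to the constant
vector `τ`. This is where the maximal speed enters. -/
theorem re_inner_phaseShift_le {A : UnitAddTorus (Fin N) → Matrix (Fin N) (Fin N) ℝ}
    {ρ : UnitAddTorus (Fin N) → ℝ} {c : ℝ}
    (hA : ∀ᵐ y, ∀ ξ : Fin N → ℝ,
      ∑ i, ∑ j, A y i j * ξ j * ξ i ≤ c ^ 2 * ρ y * ∑ i, ξ i ^ 2)
    {𝒜 : TorusVectorL2 N →L[ℂ] TorusVectorL2 N}
    (h𝒜 : ∀ p q : TorusVectorL2 N,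
      Integrable (fun y => ∑ i, ∑ j, (A y i j : ℂ) * p j y * (starRingEnd ℂ) (q i y)) ∧
      inner ℂ q (𝒜 p) = ∫ y, ∑ i, ∑ j, (A y i j : ℂ) * p j y * (starRingEnd ℂ) (q i y))
    (τ : EuclideanSpace ℝ (Fin N)) (u : TorusL2 N)
    (hu : Integrable fun y => ρ y * ‖u y‖ ^ 2) :
    (inner ℂ (phaseShift τ u) (𝒜 (phaseShift τ u))).re
      ≤ (2 * Real.pi * c * ‖τ‖) ^ 2 * ∫ y, ρ y * ‖u y‖ ^ 2 := by
  obtain ⟨h1, h2⟩ := h𝒜 (phaseShift τ u) (phaseShift τ u)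
  have hae : (fun y => ∑ i, ∑ j, (A y i j : ℂ) * phaseShift τ u j y *
      (starRingEnd ℂ) (phaseShift τ u i y)) =ᵐ[volume] fun y =>
      (((2 * Real.pi) ^ 2 * (∑ i, ∑ j, A y i j * τ j * τ i) * ‖u y‖ ^ 2 : ℝ) : ℂ) := by
    have hj : ∀ j, phaseShift τ u j =ᵐ[volume]
        fun y => 2 * Complex.I * (Real.pi : ℂ) * (τ j : ℂ) * u y := fun j => by
      rw [phaseShift_apply]
      exact Lp.coeFn_smul _ u
    filter_upwards [eventually_all.mpr hj] with y hy
    simp only [hy]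
    have h3 : u y * (starRingEnd ℂ) (u y) = ((‖u y‖ ^ 2 : ℝ) : ℂ) := by
      rw [Complex.mul_conj']; simp
    push_cast at h3 ⊢
    rw [← h3, Finset.mul_sum, Finset.sum_mul]
    refine Finset.sum_congr rfl fun i _ => ?_
    rw [Finset.mul_sum, Finset.sum_mul]
    refine Finset.sum_congr rfl fun j _ => ?_
    simp only [map_mul, Complex.conj_ofReal, Complex.conj_I, Complex.conj_ofNat]
    linear_combination (-4 * (A y i j : ℂ) * (Real.pi : ℂ) ^ 2 * (τ j : ℂ) * (τ i : ℂ) * u y *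
      (starRingEnd ℂ) (u y)) * Complex.I_sq
  have hint : Integrable fun y =>
      (2 * Real.pi) ^ 2 * (∑ i, ∑ j, A y i j * τ j * τ i) * ‖u y‖ ^ 2 := by
    have := (h1.congr hae).re
    simpa only [RCLike.re_eq_complex_re, Complex.ofReal_re] using this
  rw [h2, integral_congr_ae hae, integral_complex_ofReal, Complex.ofReal_re, ← integral_const_mul]
  refine integral_mono_ae hint (hu.const_mul _) ?_
  filter_upwards [hA] with y hy
  have h4 := hy τ
  rw [← EuclideanSpace.real_norm_sq_eq] at h4
  calc (2 * Real.pi) ^ 2 * (∑ i, ∑ j, A y i j * τ j * τ i) * ‖u y‖ ^ 2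
      ≤ (2 * Real.pi) ^ 2 * (c ^ 2 * ρ y * ‖τ‖ ^ 2) * ‖u y‖ ^ 2 := by gcongr
    _ = (2 * Real.pi * c * ‖τ‖) ^ 2 * (ρ y * ‖u y‖ ^ 2) := by ring

end GroupVelocity

end

/-! ### The derivative of the eigenvalue and the group velocity bound -/

noncomputable section

section GroupVelocity

open Filter Topology ContinuousLinearMap

variable {N : ℕ}

/-- A simple positive eigenvalue of the Bloch cell problem is differentiable, and its derivative
is controlled by the maximal speed of propagation. -/
theorem exists_hasFDerivAt_blochEigenvalue
    {A : UnitAddTorus (Fin N) → Matrix (Fin N) (Fin N) ℝ} {ρ : UnitAddTorus (Fin N) → ℝ}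
    (hA : ∀ i j, MemLp (fun y => A y i j) ⊤ volume)
    (hA_symm : ∀ᵐ y, (A y).IsSymm)
    (hA_coercive : ∃ α : ℝ, 0 < α ∧ ∀ᵐ y, ∀ ξ : Fin N → ℝ,
      α * ∑ i, ξ i ^ 2 ≤ ∑ i, ∑ j, A y i j * ξ j * ξ i)
    (hρ : MemLp ρ ⊤ volume)
    (hρ_lower : ∃ r : ℝ, 0 < r ∧ ∀ᵐ y, r ≤ ρ y)
    {θ₀ : EuclideanSpace ℝ (Fin N)} {n : ℕ}
    (h_simple : IsSimpleBlochEigenvalue A ρ θ₀ (blochEigenvalue A ρ n θ₀))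
    (h_pos : 0 < blochEigenvalue A ρ n θ₀) :
    ∃ ℓ : EuclideanSpace ℝ (Fin N) →L[ℝ] ℝ, HasFDerivAt (blochEigenvalue A ρ n) ℓ θ₀ ∧
      ∀ τ, |ℓ τ| ≤ 4 * Real.pi * Real.sqrt (blochEigenvalue A ρ n θ₀) * maxSpeed A ρ * ‖τ‖ := by
  obtain ⟨α, hα, hAα⟩ := hA_coercive
  obtain ⟨r, hr, hρr⟩ := hρ_lower
  obtain ⟨hc0, hAc⟩ := ae_quadratic_form_le_maxSpeed hA hA_symm hr hρr
  obtain ⟨𝒜, h𝒜⟩ := exists_matrix_multiplication_operator hA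
  obtain ⟨M, hM⟩ := exists_multiplication_operator hρ
  have h𝒜α := matrix_multiplication_coercive hA_symm hAα h𝒜
  have hMr := multiplication_coercive hρr hM
  have h𝒜pos : 𝒜.IsPositive := isPositive_of_inner_eq_ofReal fun p => by
    obtain ⟨a, ha, h⟩ := h𝒜α p
    exact ⟨a, le_trans (by positivity) ha, h⟩
  have hpencil := isCoercivePencil_blochOperator hα hr h𝒜α fun u =>
    ⟨_, (hMr u).2.1, (hMr u).2.2⟩
  have hEig := fun θ => blochEigenvalue_eq_sInf h𝒜 hM n θ
  set B := densityOperator M with hB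
  obtain ⟨ψ, hψ, hψu⟩ := h_simple
  set l := blochEigenvalue A ρ n θ₀ with hl
  obtain ⟨u₀, hu₀, rfl, hTu₀⟩ := (isBlochEigenfunction_iff h𝒜 hM θ₀ l ψ).mp hψ
  rw [← hB] at hTu₀
  -- The infimum of the empty set of reals is `0`, so a positive eigenvalue guarantees that levels
  -- exist.
  have hne : (pencilLevels (blochOperator 𝒜 θ₀) B (n + 1)).Nonempty := by
    by_contra hemp
    rw [Set.not_nonempty_iff_eq_empty] at hemp
    rw [hl, hEig, hemp, Real.sInf_empty] at h_pos
    exact lt_irrefl _ h_pos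
  have hsimple : ∀ u, blochOperator 𝒜 θ₀ u = (l : ℂ) • B u → ∃ a : ℂ, u = a • u₀ := by
    intro u hu
    by_cases h0 : u = 0
    · exact ⟨0, by rw [h0, zero_smul]⟩
    obtain ⟨a, ha⟩ := hψu _ ((isBlochEigenfunction_iff h𝒜 hM θ₀ l _).mpr ⟨u, h0, rfl, hu⟩)
    exact ⟨a, injective_sobolevEmbedding (by rw [ha, map_smul])⟩
  obtain ⟨C, c, hpen⟩ := hpencil θ₀
  set b := (inner ℂ u₀ (B u₀)).re with hb
  have hb0 : 0 < b := hpen.inner_right_pos hu₀ hTu₀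
  have hbint : b = ∫ y, ρ y * ‖sobolevEmbedding N u₀ y‖ ^ 2 := by
    rw [hb, hB, inner_densityOperator, (hMr _).2.2, Complex.ofReal_re]
  set w := 𝒜 (blochGradient θ₀ u₀) with hw
  let ℓ₀ : EuclideanSpace ℝ (Fin N) →ₗ[ℝ] ℝ :=
    { toFun := fun τ => 2 / b * (inner ℂ (phaseShift τ (sobolevEmbedding N u₀)) w).re
      map_add' := fun τ σ => by
        rw [phaseShift_add, add_apply, inner_add_left, Complex.add_re, mul_add]
      map_smul' := fun a τ => by
        rw [phaseShift_smul, smul_apply, inner_smul_left, Complex.conj_ofReal,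
          Complex.re_ofReal_mul, RingHom.id_apply, smul_eq_mul]
        ring }
  set ℓ := LinearMap.toContinuousLinearMap ℓ₀ with hℓ
  have hℓapp : ∀ τ, ℓ τ = 2 / b * (inner ℂ (phaseShift τ (sobolevEmbedding N u₀)) w).re :=
    fun _ => rfl
  refine ⟨ℓ, ?_, fun τ => ?_⟩
  · have h1 : HasFDerivAt (fun θ => sInf (pencilLevels (blochOperator 𝒜 θ) B (n + 1))) ℓ θ₀ := by
      refine hasFDerivAt_sInf_pencilLevels hpencil
        (L := fun τ => formCrossOperator 𝒜 (blochGradient θ₀) (phaseShift τ ∘L sobolevEmbedding N))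
        (M := 2 * ‖blochGradient θ₀‖ * ‖𝒜‖ * (2 * Real.pi * ‖sobolevEmbedding N‖))
        (fun τ => ?_) (isLittleO_blochOperator 𝒜 θ₀) hne hu₀ ?_ ?_ fun τ => ?_
      · refine (norm_formCrossOperator_le _ _ _).trans ?_
        calc _ ≤ 2 * ‖blochGradient θ₀‖ * ‖𝒜‖ * ((2 * Real.pi * ‖τ‖) * ‖sobolevEmbedding N‖) := by
              gcongr
              exact (opNorm_comp_le _ _).trans (by gcongr; exact norm_phaseShift_le _)
          _ = _ := by ring
      · rwa [← hEig]
      · rwa [← hEig]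
      · rw [re_inner_formCrossOperator h𝒜pos, hℓapp, ← hb]
        change _ = 2 * (inner ℂ (phaseShift τ (sobolevEmbedding N u₀)) w).re
        field_simp
    have h2 : blochEigenvalue A ρ n
        = fun θ => sInf (pencilLevels (blochOperator 𝒜 θ) B (n + 1)) := funext hEig
    rw [h2]
    exact h1
  · set e := (inner ℂ (phaseShift τ (sobolevEmbedding N u₀)) w).re with he
    -- Cauchy–Schwarz for `𝒜`, with the phase-shift energy in the first factor and the Bloch energy
    -- `l b` in the second. The resulting `b` in the bound on `|e|` cancels against `2 / b`.
    have h1 : e ^ 2 ≤ (2 * Real.pi * maxSpeed A ρ * ‖τ‖) ^ 2 * b * (l * b) := by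
      refine (sq_re_inner_le_of_isPositive h𝒜pos _ _).trans ?_
      have h2 := re_inner_phaseShift_le hAc h𝒜 τ (sobolevEmbedding N u₀) (hMr _).1
      rw [← hbint] at h2
      have h3 : (inner ℂ (blochGradient θ₀ u₀) (𝒜 (blochGradient θ₀ u₀))).re = l * b := by
        rw [← inner_blochOperator, hTu₀, inner_smul_right, Complex.re_ofReal_mul]
      rw [h3]
      exact mul_le_mul_of_nonneg_right h2 (by positivity)
    have h4 : |e| ≤ 2 * Real.pi * maxSpeed A ρ * ‖τ‖ * Real.sqrt l * b := by
      have hpi := Real.pi_pos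
      refine abs_le_of_sq_le_sq ?_ (by positivity)
      refine h1.trans (le_of_eq ?_)
      rw [mul_pow (2 * Real.pi * maxSpeed A ρ * ‖τ‖ * Real.sqrt l), mul_pow _ (Real.sqrt l),
        Real.sq_sqrt h_pos.le]
      ring
    rw [hℓapp, abs_mul, abs_of_pos (by positivity : 0 < 2 / b), div_mul_eq_mul_div,
      div_le_iff₀ hb0]
    linarith

end GroupVelocity

end

theorem theorem1 (N : ℕ)
    (A : UnitAddTorus (Fin N) → Matrix (Fin N) (Fin N) ℝ)
    (ρ : UnitAddTorus (Fin N) → ℝ)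
    (hA : ∀ i j, MemLp (fun y => A y i j) ⊤ volume)
    (hA_symm : ∀ᵐ y, (A y).IsSymm)
    (hA_coercive : ∃ α : ℝ, 0 < α ∧ ∀ᵐ y, ∀ ξ : Fin N → ℝ,
      α * ∑ i, ξ i ^ 2 ≤ ∑ i, ∑ j, A y i j * ξ j * ξ i)
    (hρ : MemLp ρ ⊤ volume)
    (hρ_lower : ∃ r : ℝ, 0 < r ∧ ∀ᵐ y, r ≤ ρ y)
    (θ₀ : EuclideanSpace ℝ (Fin N)) (n : ℕ)
    (h_simple : IsSimpleBlochEigenvalue A ρ θ₀ (blochEigenvalue A ρ n θ₀))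
    (h_pos : 0 < blochEigenvalue A ρ n θ₀) :
    DifferentiableAt ℝ (blochEigenvalue A ρ n) θ₀ ∧
    DifferentiableAt ℝ (blochFrequency A ρ n) θ₀ ∧
    groupVelocity A ρ n θ₀ =
      -((4 * Real.pi * Real.sqrt (blochEigenvalue A ρ n θ₀))⁻¹ •
        gradient (blochEigenvalue A ρ n) θ₀) ∧
    ‖groupVelocity A ρ n θ₀‖ ≤ maxSpeed A ρ := by
  obtain ⟨ℓ, hℓ, hbound⟩ := exists_hasFDerivAt_blochEigenvalue hA hA_symm hA_coercive hρ hρ_lower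
    h_simple h_pos
  have hc0 : 0 ≤ maxSpeed A ρ := by
    obtain ⟨r, hr, hρr⟩ := hρ_lower
    exact (ae_quadratic_form_le_maxSpeed hA hA_symm hr hρr).1
  set l := blochEigenvalue A ρ n θ₀ with hl
  have hpi := Real.pi_pos
  have hsl : 0 < Real.sqrt l := Real.sqrt_pos.mpr h_pos
  have hω : HasFDerivAt (blochFrequency A ρ n) ((4 * Real.pi * Real.sqrt l)⁻¹ • ℓ) θ₀ := by
    have h1 := (hℓ.sqrt h_pos.ne').const_mul (2 * Real.pi)⁻¹
    have h2 : (fun θ => (2 * Real.pi)⁻¹ * Real.sqrt (blochEigenvalue A ρ n θ))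
        = blochFrequency A ρ n := by
      funext θ
      rw [blochFrequency, div_eq_inv_mul]
    rw [h2, smul_smul] at h1
    have h3 : (2 * Real.pi)⁻¹ * (1 / (2 * Real.sqrt l)) = (4 * Real.pi * Real.sqrt l)⁻¹ := by
      field_simp
      norm_num
    rw [← h3]
    exact h1
  have hgrad : groupVelocity A ρ n θ₀
      = -((4 * Real.pi * Real.sqrt l)⁻¹ • gradient (blochEigenvalue A ρ n) θ₀) := by
    rw [groupVelocity, gradient, gradient, hω.fderiv, hℓ.fderiv, map_smul]
  refine ⟨hℓ.differentiableAt, hω.differentiableAt, hgrad, ?_⟩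
  -- The Riesz map is isometric, so the gradient has the operator norm of `ℓ`.
  rw [hgrad, norm_neg, norm_smul, gradient, LinearIsometryEquiv.norm_map, hℓ.fderiv,
    Real.norm_of_nonneg (by positivity), inv_mul_le_iff₀ (by positivity)]
  exact ContinuousLinearMap.opNorm_le_bound _ (by positivity) hbound
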